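/- Let $F$ be a non-archimedean local field of odd residue characteristic $p$, $E/F$ the unramified quadratic extension with nontrivial conjugation $x\mapsto\bar x$, $\mathfrak o_E\supset\mathfrak p_E$ its ring of integers and maximal ideal, and $\varpi\in F$ a uniformizer of $E$. Let $G=U(2,1)(E/F)$ be the subgroup of $GL_3(E)$ preserving the Hermitian form $h(v,w)=v^{T}\beta\bar w$ on $E^3$, where $\beta$ is the antidiagonal matrix with entries $1,1,1$, and put $\alpha=\mathrm{diag}(\varpi^{-1},1,\varpi)\in G$. Let $K$ be one of the maximal compact open subgroups $$K_0=G\cap\begin{pmatrix}\mathfrak o_E&\mathfrak o_E&\mathfrak o_E\\ \mathfrak o_E&\mathfrak o_E&\mathfrak o_E\\ \mathfrak o_E&\mathfrak o_E&\mathfrak o_E\end{pmatrix},\qquad K_1=G\cap\begin{pmatrix}\mathfrak o_E&\mathfrak o_E&\mathfrak p_E^{-1}\\ \mathfrak p_E&\mathfrak o_E&\mathfrak o_E\\ \mathfrak p_E&\mathfrak p_E&\mathfrak o_E\end{pmatrix},$$ let $K^1$ be its maximal normal pro-$p$ subgroup, let $I_K$ (resp. $I'_K$) be the inverse image in $K$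 of the upper (resp. lower) triangular subgroup of $K/K^1$, and let $I_{1,K}$ (resp. $I'_{1,K}$) be the inverse image of its unipotent radical. Let $\sigma$ be an irreducible smooth representation of $K$ over $\overline{\mathbf F}_p$. Let $\mathrm{ind}_K^G\sigma$ be the space of locally constant, compactly supported functions $f:G\to\sigma$ with $f(\kappa g)=\sigma(\kappa)f(g)$ for $\kappa\in K$, on which $G$ acts by right translation. The composition $\sigma^{I_{1,K}}\hookrightarrow\sigma\twoheadrightarrow\sigma_{I'_{1,K}}$ is known to be an isomorphism; let $j_\sigma:\sigma\twoheadrightarrow\sigma_{I'_{1,K}}\cong\sigma^{I_{1,K}}\subseteq\sigma$ be the map given by its inverse. Let $\varphi:G\to\mathrm{End}(\sigma)$ be the function supported on $K\alpha K$ with $\varphi(\kappa\alpha\kappa')=\sigma(\kappa)j_\sigma\sigma(\kappa')$ for $\kappa,\kappa'\in K$, and let $T\in\mathrm{End}_G(\mathrm{ind}_K^G\sigma)$ be the Hecke operator $(Tf)(g)=\sum_{y\in G/K}\varphi(y)f(y^{-1}g)$. For $n\ge 0$ let $R_n^+(\sigma)$ and $R_n^-(\sigma)$ be the spaces of functions in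 $\mathrm{ind}_K^G\sigma$ supported in $K\alpha^nI_K$ and in $K\alpha^{-(n+1)}I_K$ respectively, and put $I^+(\sigma)=\bigoplus_{n\ge 0}R_n^+(\sigma)$, $I^-(\sigma)=\bigoplus_{n\ge 0}R_n^-(\sigma)$. Let $P\in\overline{\mathbf F}_p[x]$ be a polynomial of degree $\ge 1$, let $\pi=\mathrm{ind}_K^G\sigma/(P(T))$ be the quotient by the image of $P(T)$, and let $I^\pm(\sigma,\pi)$ be the image of $I^\pm(\sigma)$ in $\pi$. Then $$I^+(\sigma,\pi)\cap I^-(\sigma,\pi)\subseteq\pi^{I_{1,K}}.$$ -/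

import Mathlib

namespace U21

/-- A quadratic extension `E / F` of normed fields (the norm of `E` extends that of `F`), with its
nontrivial Galois conjugation `conj` and an element `ϖ` of `F` that generates the maximal ideal
`{x | ‖x‖ < 1}` of the ring of integers of `E`. The existence of such a `ϖ` in `F` says that
`E / F` is unramified. -/
structure UnramifiedQuadratic (F E : Type*) [NontriviallyNormedField F] [NormedField E]
    [NormedAlgebra F E] where
  finrank_eq_two : Module.finrank F E = 2
  conj : E ≃ₐ[F] E
  conj_ne_refl : conj ≠ AlgEquiv.refl
  ϖ : F
  ϖ_ne_zero : ϖ ≠ 0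
  norm_ϖ_lt_one : ‖ϖ‖ < 1
  norm_le_norm_ϖ : ∀ x : E, ‖x‖ < 1 → ‖x‖ ≤ ‖ϖ‖

section Group

variable {F E : Type*} [NontriviallyNormedField F] [NormedField E] [NormedAlgebra F E]
  (D : UnramifiedQuadratic F E)

/-- The matrix `β`. -/
def betaMat (E : Type*) [NormedField E] : Matrix (Fin 3) (Fin 3) E := !![0, 0, 1; 0, 1, 0; 1, 0, 0]

/-- The Hermitian form `h(v, w) = vᵀ β w̄` on `E³`. -/
def herm (v w : Fin 3 → E) : E :=
  v ⬝ᵥ (betaMat E).mulVec (fun i => D.conj (w i))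

/-- The unitary group `G = U(2, 1)(E / F)`. -/
def unitaryG : Subgroup (GL (Fin 3) E) where
  carrier := {g | ∀ v w : Fin 3 → E,
    herm D (g.1.mulVec v) (g.1.mulVec w) = herm D v w}
  one_mem' := by intro v w; simp
  mul_mem' := by
    intro a b ha hb v w
    simp only [Units.val_mul, ← Matrix.mulVec_mulVec]
    rw [ha, hb]
  inv_mem' := by
    intro a ha v w
    rw [← ha]
    simp [Matrix.mulVec_mulVec]

/-- The matrix of an element of `G`. -/
def mat (g : unitaryG D) : Matrix (Fin 3) (Fin 3) E := ((g : GL (Fin 3) E) : Matrix (Fin 3) (Fin 3) E)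

theorem mat_one : mat D 1 = 1 := rfl

theorem mat_mul (g h : unitaryG D) : mat D (g * h) = mat D g * mat D h := rfl

theorem herm_apply (v w : Fin 3 → E) :
    herm D v w = v 0 * D.conj (w 2) + v 1 * D.conj (w 1) + v 2 * D.conj (w 0) := by
  simp [herm, betaMat, dotProduct, Matrix.mulVec, Fin.sum_univ_three, Matrix.cons_val_zero]

theorem unitaryG_rel (g : unitaryG D) (a b : Fin 3) :
    mat D g 0 a * D.conj (mat D g 2 b) + mat D g 1 a * D.conj (mat D g 1 b) +
      mat D g 2 a * D.conj (mat D g 0 b) = if b = a.rev then 1 else 0 := by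
  have h := g.2 (Pi.single a 1) (Pi.single b 1)
  rw [herm_apply, herm_apply] at h
  simp only [Matrix.mulVec_single_one, Matrix.col_apply] at h
  refine Eq.trans h ?_
  fin_cases a <;> fin_cases b <;> simp [Fin.rev]

theorem mat_inv (g : unitaryG D) (i j : Fin 3) :
    mat D g⁻¹ i j = D.conj (mat D g j.rev i.rev) := by
  have h : (Matrix.of fun i j : Fin 3 => D.conj (mat D g j.rev i.rev)) * mat D g = 1 := by
    ext a b
    have h := unitaryG_rel D g b a.rev
    rw [Matrix.mul_apply, Fin.sum_univ_three, Matrix.one_apply]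
    simp only [Matrix.of_apply]
    have e : (if a = b then (1 : E) else 0) = if a.rev = b.rev then 1 else 0 := by
      simp
    rw [e, ← h]
    change D.conj (mat D g 2 a.rev) * _ + D.conj (mat D g 1 a.rev) * _ + D.conj (mat D g 0 a.rev) * _ = _
    ring
  have h2 : mat D g * mat D g⁻¹ = 1 := by rw [← mat_mul, mul_inv_cancel, mat_one]
  have : mat D g⁻¹ = Matrix.of fun i j : Fin 3 => D.conj (mat D g j.rev i.rev) := by
    rw [← one_mul (mat D g⁻¹), ← h, mul_assoc, h2, mul_one]
  rw [this]; rfl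

theorem mem_unitaryG_of_rel (g : GL (Fin 3) E)
    (h : ∀ a b : Fin 3, g.1 0 a * D.conj (g.1 2 b) + g.1 1 a * D.conj (g.1 1 b) +
      g.1 2 a * D.conj (g.1 0 b) = if b = a.rev then 1 else 0) : g ∈ unitaryG D := by
  intro v w
  rw [herm_apply, herm_apply]
  simp only [Matrix.mulVec, dotProduct, Fin.sum_univ_three, map_add, map_mul]
  have h00 := h 0 0
  have h01 := h 0 1
  have h02 := h 0 2
  have h10 := h 1 0
  have h11 := h 1 1
  have h12 := h 1 2
  have h20 := h 2 0
  have h21 := h 2 1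
  have h22 := h 2 2
  simp [Fin.rev] at h00 h01 h02 h10 h11 h12 h20 h21 h22
  linear_combination (v 0 * D.conj (w 0)) * h00 + (v 0 * D.conj (w 1)) * h01 +
    (v 0 * D.conj (w 2)) * h02 + (v 1 * D.conj (w 0)) * h10 + (v 1 * D.conj (w 1)) * h11 +
    (v 1 * D.conj (w 2)) * h12 + (v 2 * D.conj (w 0)) * h20 + (v 2 * D.conj (w 1)) * h21 +
    (v 2 * D.conj (w 2)) * h22

theorem ϖ_ne_zero' : algebraMap F E D.ϖ ≠ 0 := by
  simpa using D.ϖ_ne_zero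

/-- The diagonal matrix `α = diag(ϖ⁻¹, 1, ϖ)` of `G`. -/
def alpha : unitaryG D :=
  ⟨⟨Matrix.diagonal ![(algebraMap F E D.ϖ)⁻¹, 1, algebraMap F E D.ϖ],
    Matrix.diagonal ![algebraMap F E D.ϖ, 1, (algebraMap F E D.ϖ)⁻¹],
    by
      have := ϖ_ne_zero' D
      rw [Matrix.diagonal_mul_diagonal, ← Matrix.diagonal_one]
      congr 1; ext i; fin_cases i <;> simp [this],
    by
      have := ϖ_ne_zero' D
      rw [Matrix.diagonal_mul_diagonal, ← Matrix.diagonal_one]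
      congr 1; ext i; fin_cases i <;> simp [this]⟩, by
    have := ϖ_ne_zero' D
    apply mem_unitaryG_of_rel
    intro a b
    fin_cases a <;> fin_cases b <;> simp [Matrix.diagonal, Fin.rev, this]⟩

end Group

section Ideals

variable {F E : Type*} [NontriviallyNormedField F] [NormedField E] [NormedAlgebra F E]
  (D : UnramifiedQuadratic F E)

theorem finiteDim (D : UnramifiedQuadratic F E) : FiniteDimensional F E :=
  FiniteDimensional.of_finrank_pos (by rw [D.finrank_eq_two]; norm_num)

/-- `x` lies in the fractional ideal `𝔭_E ^ n = ϖ ^ n 𝔬_E`. -/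
def InPow (n : ℤ) (x : E) : Prop := ‖x‖ ≤ ‖D.ϖ‖ ^ n

/-- A matrix of exponents `e` is a level if the matrices with entries `x i j ∈ 𝔭_E ^ (e i j)` form
a ring stable under the adjoint involution of the Hermitian form. -/
structure IsLevel (e : Matrix (Fin 3) (Fin 3) ℤ) : Prop where
  diag : ∀ i, e i i = 0
  tri : ∀ i j l, e i l ≤ e i j + e j l
  symm : ∀ i j, e j.rev i.rev = e i j

/-- A level for which taking diagonal entries modulo `𝔭_E` is multiplicative. -/
structure IsIwahoriLevel (e : Matrix (Fin 3) (Fin 3) ℤ) : Prop extends IsLevel e where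
  one_le : ∀ i j, i ≠ j → 1 ≤ e i j + e j i

variable {D}

theorem norm_ϖ_pos : 0 < ‖D.ϖ‖ := by simpa using D.ϖ_ne_zero

theorem InPow.mul {m n : ℤ} {x y : E} (hx : InPow D m x) (hy : InPow D n y) :
    InPow D (m + n) (x * y) := by
  unfold InPow at *
  rw [norm_mul, zpow_add₀ (norm_ϖ_pos.ne')]
  exact mul_le_mul hx hy (norm_nonneg _) (by positivity)

theorem InPow.mono {m n : ℤ} {x : E} (hx : InPow D m x) (h : n ≤ m) : InPow D n x :=
  hx.trans (zpow_le_zpow_right_of_le_one₀ norm_ϖ_pos D.norm_ϖ_lt_one.le h)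

theorem InPow.zero (n : ℤ) : InPow D n (0 : E) := by
  unfold InPow; rw [norm_zero]; positivity

theorem InPow.one : InPow D 0 (1 : E) := by simp [InPow]

theorem InPow.neg {n : ℤ} {x : E} (hx : InPow D n x) : InPow D n (-x) := by
  unfold InPow at *; rwa [norm_neg]

end Ideals

section Ultra

variable {F E : Type*} [NontriviallyNormedField F] [IsUltrametricDist F]
  [NormedField E] [NormedAlgebra F E] {D : UnramifiedQuadratic F E}

theorem InPow.add {n : ℤ} {x y : E} (hx : InPow D n x) (hy : InPow D n y) :
    InPow D n (x + y) := by
  have : IsUltrametricDist E := IsUltrametricDist.of_normedAlgebra F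
  exact (IsUltrametricDist.norm_add_le_max x y).trans (max_le hx hy)

theorem InPow.sub {n : ℤ} {x y : E} (hx : InPow D n x) (hy : InPow D n y) :
    InPow D n (x - y) := by
  rw [sub_eq_add_neg]; exact hx.add hy.neg

theorem isUnit_of_sub_one {x : E} (hx : InPow D 1 (x - 1)) : ‖x‖ = 1 := by
  have : IsUltrametricDist E := IsUltrametricDist.of_normedAlgebra F
  have h1 : ‖x - 1‖ < ‖(1 : E)‖ := by
    rw [norm_one]; exact lt_of_le_of_lt hx (by simpa using D.norm_ϖ_lt_one)
  have := IsUltrametricDist.norm_add_eq_max_of_norm_ne_norm h1.ne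
  rw [sub_add_cancel, max_eq_right h1.le, norm_one] at this
  exact this

theorem inPow_entry_mul {e₁ e₂ : Matrix (Fin 3) (Fin 3) ℤ} {A B : Matrix (Fin 3) (Fin 3) E}
    (hA : ∀ i j, InPow D (e₁ i j) (A i j)) (hB : ∀ i j, InPow D (e₂ i j) (B i j)) {n : ℤ}
    {i l : Fin 3} (h : ∀ j, n ≤ e₁ i j + e₂ j l) : InPow D n ((A * B) i l) := by
  rw [Matrix.mul_apply, Fin.sum_univ_three]
  exact ((((hA i 0).mul (hB 0 l)).mono (h 0)).add (((hA i 1).mul (hB 1 l)).mono (h 1))).add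
    (((hA i 2).mul (hB 2 l)).mono (h 2))

theorem diag_mul_sub {e₁ e₂ : Matrix (Fin 3) (Fin 3) ℤ} {A B : Matrix (Fin 3) (Fin 3) E}
    (hA : ∀ i j, InPow D (e₁ i j) (A i j)) (hB : ∀ i j, InPow D (e₂ i j) (B i j))
    {i : Fin 3} (h : ∀ j, j ≠ i → 1 ≤ e₁ i j + e₂ j i) :
    InPow D 1 ((A * B) i i - A i i * B i i) := by
  rw [Matrix.mul_apply, ← Finset.sum_erase_add _ _ (Finset.mem_univ i), add_sub_cancel_right]
  refine Finset.sum_induction _ (InPow D 1) (fun _ _ => InPow.add) (InPow.zero 1) ?_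
  intro j hj
  exact ((hA i j).mul (hB j i)).mono (h j (Finset.ne_of_mem_erase hj))

variable [ProperSpace F]

theorem norm_conj (x : E) : ‖D.conj x‖ = ‖x‖ := by
  have := finiteDim D
  let f : AbsoluteValue E ℝ :=
    { toFun := fun x => ‖D.conj x‖
      map_mul' := by intro x y; simp
      nonneg' := by intro x; positivity
      eq_zero' := by intro x; simp
      add_le' := by intro x y; rw [map_add]; exact norm_add_le _ _ }
  have h1 := spectralNorm_unique_field_norm_ext (K := F) (f := f)
    (by intro x; change ‖D.conj _‖ = _; simp) x
  rw [NormedAlgebra.norm_eq_spectralNorm F x, ← h1]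
  rfl

theorem InPow.conj {n : ℤ} {x : E} (hx : InPow D n x) : InPow D n (D.conj x) := by
  unfold InPow; rwa [norm_conj]

variable (D)

/-- The subgroup of all `g ∈ G` whose entries satisfy `g i j ∈ 𝔭_E ^ (e i j)`. -/
def levelGroup (e : Matrix (Fin 3) (Fin 3) ℤ) (he : IsLevel e) : Subgroup (unitaryG D) where
  carrier := {g | ∀ i j, InPow D (e i j) (mat D g i j)}
  one_mem' := by
    intro i j
    rw [mat_one, Matrix.one_apply]
    split_ifs with h
    · subst h; rw [he.diag]; exact InPow.one
    · exact InPow.zero _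
  mul_mem' := by
    intro a b ha hb i j
    rw [mat_mul]
    exact inPow_entry_mul ha hb fun l => he.tri i l j
  inv_mem' := by
    intro a ha i j
    rw [mat_inv, ← he.symm]
    exact (ha _ _).conj

/-- The subgroup of all `g ∈ G` whose entries satisfy `g i j ∈ 𝔭_E ^ (e i j)`, with diagonal entries
in `1 + 𝔭_E`. -/
def levelGroup₁ (e : Matrix (Fin 3) (Fin 3) ℤ) (he : IsIwahoriLevel e) :
    Subgroup (unitaryG D) where
  carrier := {g | (∀ i j, InPow D (e i j) (mat D g i j)) ∧ ∀ i, InPow D 1 (mat D g i i - 1)}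
  one_mem' := by
    refine ⟨(levelGroup D e he.toIsLevel).one_mem, fun i => ?_⟩
    rw [mat_one, Matrix.one_apply_eq, sub_self]
    exact InPow.zero _
  mul_mem' := by
    intro a b ha hb
    refine ⟨(levelGroup D e he.toIsLevel).mul_mem ha.1 hb.1, fun i => ?_⟩
    have h1 := diag_mul_sub ha.1 hb.1 (i := i) (fun j hj => he.one_le i j hj.symm)
    have h2 := ((ha.2 i).mul (((hb.1 i i).mono (he.diag i).ge)))
    have h3 := (h1.add h2).add (hb.2 i)
    rw [mat_mul]
    convert h3 using 1
    ring
  inv_mem' := by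
    intro a ha
    refine ⟨(levelGroup D e he.toIsLevel).inv_mem ha.1, fun i => ?_⟩
    rw [mat_inv]
    have := (ha.2 i.rev).conj
    simpa using this

variable {D}

theorem mem_levelGroup {e : Matrix (Fin 3) (Fin 3) ℤ} {he : IsLevel e} {g : unitaryG D} :
    g ∈ levelGroup D e he ↔ ∀ i j, InPow D (e i j) (mat D g i j) := Iff.rfl

theorem mem_levelGroup₁ {e : Matrix (Fin 3) (Fin 3) ℤ} {he : IsIwahoriLevel e} {g : unitaryG D} :
    g ∈ levelGroup₁ D e he ↔
      (∀ i j, InPow D (e i j) (mat D g i j)) ∧ ∀ i, InPow D 1 (mat D g i i - 1) := Iff.rfl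

theorem levelGroup₁_conj {e : Matrix (Fin 3) (Fin 3) ℤ} {he : IsIwahoriLevel e} {g u : unitaryG D}
    (hg : g ∈ levelGroup D e he.toIsLevel) (hu : u ∈ levelGroup₁ D e he) :
    g * u * g⁻¹ ∈ levelGroup₁ D e he := by
  have hgi := (levelGroup D e he.toIsLevel).inv_mem hg
  have hgu := (levelGroup D e he.toIsLevel).mul_mem hg hu.1
  refine ⟨(levelGroup D e he.toIsLevel).mul_mem hgu hgi, fun i => ?_⟩
  have h1 := diag_mul_sub hgu hgi (i := i) (fun j hj => he.one_le i j hj.symm)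
  have h2 := diag_mul_sub hg hu.1 (i := i) (fun j hj => he.one_le i j hj.symm)
  have h3 := diag_mul_sub hg hgi (i := i) (fun j hj => he.one_le i j hj.symm)
  rw [← mat_mul, mul_inv_cancel, mat_one, Matrix.one_apply_eq] at h3
  have hi0 : InPow D 0 (mat D g⁻¹ i i) := (hgi i i).mono (he.diag i).ge
  have hg0 : InPow D 0 (mat D g i i) := (hg i i).mono (he.diag i).ge
  have h4 := h2.mul hi0
  have h5 := (hg0.mul (hu.2 i)).mul hi0
  have h6 := ((h1.add (h4.mono (by norm_num))).add (h5.mono (by norm_num))).sub h3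
  rw [← mat_mul] at h6
  rw [mat_mul]
  rw [mat_mul] at h6
  convert h6 using 1
  rw [mat_mul]
  ring

end Ultra

/-- The two conjugacy classes of maximal compact open subgroups of `G`. -/
inductive MaxCpt
  | K₀
  | K₁

namespace MaxCpt

/-- The exponents of `K_0` and `K_1`. -/
def level : MaxCpt → Matrix (Fin 3) (Fin 3) ℤ
  | K₀ => !![0, 0, 0; 0, 0, 0; 0, 0, 0]
  | K₁ => !![0, 0, -1; 1, 0, 0; 1, 1, 0]

/-- The exponents of the Iwahori subgroup `I_K`, the group of all elements of `K` whose image in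
`Γ_K = K / K¹` is upper triangular. -/
def iwLevel : MaxCpt → Matrix (Fin 3) (Fin 3) ℤ
  | K₀ => !![0, 0, 0; 1, 0, 0; 1, 1, 0]
  | K₁ => !![0, 0, -1; 1, 0, 0; 2, 1, 0]

/-- The exponents of the opposite Iwahori subgroup `I'_K`, the group of all elements of `K` whose
image in `Γ_K = K / K¹` is lower triangular. -/
def iwLevel' : MaxCpt → Matrix (Fin 3) (Fin 3) ℤ
  | K₀ => !![0, 1, 1; 0, 0, 1; 0, 0, 0]
  | K₁ => !![0, 0, 0; 1, 0, 0; 1, 1, 0]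

theorem isLevel (i : MaxCpt) : IsLevel i.level := by
  refine ⟨?_, ?_, ?_⟩
  · intro a; cases i <;> fin_cases a <;> decide
  · intro a b c; cases i <;> fin_cases a <;> fin_cases b <;> fin_cases c <;> decide
  · intro a b; cases i <;> fin_cases a <;> fin_cases b <;> decide

theorem isIwahoriLevel (i : MaxCpt) : IsIwahoriLevel i.iwLevel := by
  refine ⟨⟨?_, ?_, ?_⟩, ?_⟩
  · intro a; cases i <;> fin_cases a <;> decide
  · intro a b c; cases i <;> fin_cases a <;> fin_cases b <;> fin_cases c <;> decide
  · intro a b; cases i <;> fin_cases a <;> fin_cases b <;> decide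
  · intro a b; cases i <;> fin_cases a <;> fin_cases b <;> decide

theorem isIwahoriLevel' (i : MaxCpt) : IsIwahoriLevel i.iwLevel' := by
  refine ⟨⟨?_, ?_, ?_⟩, ?_⟩
  · intro a; cases i <;> fin_cases a <;> decide
  · intro a b c; cases i <;> fin_cases a <;> fin_cases b <;> fin_cases c <;> decide
  · intro a b; cases i <;> fin_cases a <;> fin_cases b <;> decide
  · intro a b; cases i <;> fin_cases a <;> fin_cases b <;> decide

end MaxCpt

section Subgroups

variable {F E : Type*} [NontriviallyNormedField F] [IsUltrametricDist F] [ProperSpace F]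
  [NormedField E] [NormedAlgebra F E] (D : UnramifiedQuadratic F E) (i : MaxCpt)

/-- The maximal compact open subgroup `K ∈ {K_0, K_1}` of `G`. -/
def maxK : Subgroup (unitaryG D) := levelGroup D i.level i.isLevel

/-- The Iwahori subgroup `I_K`, the inverse image in `K` of the upper triangular subgroup of
`Γ_K`. -/
def iwahori : Subgroup (unitaryG D) := levelGroup D i.iwLevel i.isIwahoriLevel.toIsLevel

/-- The opposite Iwahori subgroup `I'_K`. -/
def iwahori' : Subgroup (unitaryG D) := levelGroup D i.iwLevel' i.isIwahoriLevel'.toIsLevel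

/-- The pro-`p` Iwahori subgroup `I_{1,K}`, the inverse image in `K` of the unipotent radical of the
upper triangular subgroup of `Γ_K`. -/
def proIwahori : Subgroup (unitaryG D) := levelGroup₁ D i.iwLevel i.isIwahoriLevel

/-- The opposite pro-`p` Iwahori subgroup `I'_{1,K}`. -/
def proIwahori' : Subgroup (unitaryG D) := levelGroup₁ D i.iwLevel' i.isIwahoriLevel'

theorem iwahori_le : iwahori D i ≤ maxK D i := fun g hg a b => (hg a b).mono (by
  cases i <;> fin_cases a <;> fin_cases b <;> decide)

theorem iwahori'_le : iwahori' D i ≤ maxK D i := fun g hg a b => (hg a b).mono (by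
  cases i <;> fin_cases a <;> fin_cases b <;> decide)

theorem proIwahori_le : proIwahori D i ≤ maxK D i := fun _ hg => iwahori_le D i hg.1

theorem proIwahori'_le : proIwahori' D i ≤ maxK D i := fun _ hg => iwahori'_le D i hg.1

end Subgroups

section Factorization

variable {F E : Type*} [NontriviallyNormedField F] [IsUltrametricDist F] [ProperSpace F]
  [NormedField E] [NormedAlgebra F E] {D : UnramifiedQuadratic F E} {i : MaxCpt}

theorem inPow_alpha (n : ℤ) (x : E) (m : ℤ) (hx : InPow D n x) :
    InPow D (n + m) (x * algebraMap F E D.ϖ ^ m) := by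
  refine hx.mul ?_
  unfold InPow
  rw [norm_zpow, norm_algebraMap']

theorem mat_alpha_rel {k k' : unitaryG D} (h : k * alpha D = alpha D * k') (a b : Fin 3) :
    mat D k a b = mat D k' a b * algebraMap F E D.ϖ ^ ((a : ℤ) - (b : ℤ)) := by
  have hϖ := ϖ_ne_zero' D
  have h1 : mat D (k * alpha D) a b = mat D (alpha D * k') a b := by rw [h]
  rw [mat_mul, mat_mul] at h1
  change (mat D k * Matrix.diagonal ![(algebraMap F E D.ϖ)⁻¹, 1, algebraMap F E D.ϖ]) a b =
    (Matrix.diagonal ![(algebraMap F E D.ϖ)⁻¹, 1, algebraMap F E D.ϖ] * mat D k') a b at h1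
  rw [Matrix.mul_diagonal, Matrix.diagonal_mul] at h1
  have e : ∀ a : Fin 3, ![(algebraMap F E D.ϖ)⁻¹, 1, algebraMap F E D.ϖ] a =
      algebraMap F E D.ϖ ^ ((a : ℤ) - 1) := by
    intro a; fin_cases a <;> simp
  rw [e, e] at h1
  have h2 : algebraMap F E D.ϖ ^ ((b : ℤ) - 1) ≠ 0 := zpow_ne_zero _ hϖ
  apply mul_right_cancel₀ h2
  rw [h1, mul_assoc, ← zpow_add₀ hϖ, mul_comm]
  congr 2
  ring

theorem mem_iwahori_of_alpha {k k' : unitaryG D} (hk : k ∈ maxK D i) (hk' : k' ∈ maxK D i)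
    (h : k * alpha D = alpha D * k') :
    k ∈ iwahori D i ∧ k' ∈ iwahori' D i ∧ ∀ a, mat D k a a = mat D k' a a := by
  have hr := mat_alpha_rel h
  have hϖ := ϖ_ne_zero' D
  refine ⟨fun a b => ?_, fun a b => ?_, fun a => ?_⟩
  · by_cases hab : b < a
    · rw [hr]
      refine (inPow_alpha _ _ _ (hk' a b)).mono ?_
      revert hab
      cases i <;> fin_cases a <;> fin_cases b <;> decide
    · refine (hk a b).mono ?_
      revert hab
      cases i <;> fin_cases a <;> fin_cases b <;> decide
  · by_cases hab : a < b
    · have h2 : mat D k' a b = mat D k a b * algebraMap F E D.ϖ ^ ((b : ℤ) - (a : ℤ)) := by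
        rw [hr, mul_assoc, ← zpow_add₀ hϖ]; simp
      rw [h2]
      refine (inPow_alpha _ _ _ (hk a b)).mono ?_
      revert hab
      cases i <;> fin_cases a <;> fin_cases b <;> decide
    · refine (hk' a b).mono ?_
      revert hab
      cases i <;> fin_cases a <;> fin_cases b <;> decide
  · rw [hr]; simp

/-- The lower unipotent element `n'(x, y)` of `G`. -/
def lowerUnip (D : UnramifiedQuadratic F E) (x y : E) (h : x * D.conj x + y + D.conj y = 0)
    (hc : D.conj (D.conj x) = x) : unitaryG D :=
  ⟨⟨!![1, 0, 0; x, 1, 0; y, -D.conj x, 1], !![1, 0, 0; -x, 1, 0; D.conj y, D.conj x, 1],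
    by
      ext a b
      fin_cases a <;> fin_cases b <;> simp [Matrix.mul_apply, Fin.sum_univ_three]
      linear_combination h,
    by
      ext a b
      fin_cases a <;> fin_cases b <;> simp [Matrix.mul_apply, Fin.sum_univ_three]
      linear_combination h⟩, by
    apply mem_unitaryG_of_rel
    intro a b
    fin_cases a <;> fin_cases b <;> simp [Fin.rev, hc]
    linear_combination h⟩

theorem conj_conj (D : UnramifiedQuadratic F E) (x : E) : D.conj (D.conj x) = x := by
  have := finiteDim D
  classical
  have hcard : Nat.card (E ≃ₐ[F] E) ≤ 2 := by
    rw [Nat.card_eq_fintype_card, ← D.finrank_eq_two]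
    exact AlgEquiv.card_le
  have h1 : D.conj * D.conj = 1 := by
    by_contra hne
    have h2 : D.conj ≠ 1 := D.conj_ne_refl
    have h3 : D.conj * D.conj ≠ D.conj := by
      intro h; exact h2 (mul_left_cancel (h.trans (mul_one _).symm))
    have : ({1, D.conj, D.conj * D.conj} : Finset (E ≃ₐ[F] E)).card = 3 := by
      rw [Finset.card_eq_three]
      exact ⟨1, D.conj, D.conj * D.conj, h2.symm, Ne.symm hne, h3.symm, rfl⟩
    have h4 := Finset.card_le_univ ({1, D.conj, D.conj * D.conj} : Finset (E ≃ₐ[F] E))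
    rw [Nat.card_eq_fintype_card] at hcard
    omega
  exact DFunLike.congr_fun h1 x

theorem exists_factor {k k' : unitaryG D} (hk : k ∈ iwahori D i) (hk' : k' ∈ iwahori' D i)
    (hd : ∀ a, mat D k a a = mat D k' a a) :
    ∃ n ∈ proIwahori' D i, ∃ b ∈ proIwahori D i, k = k' * n * b := by
  obtain ⟨x, hx⟩ : ∃ x, x = k'⁻¹ * k := ⟨_, rfl⟩
  have hki := (iwahori' D i).inv_mem hk'
  have hxK : x ∈ maxK D i := hx ▸ (maxK D i).mul_mem (iwahori'_le D i hki) (iwahori_le D i hk)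
  have hx00 : InPow D 1 (mat D x 0 0 - 1) := by
    have h1 := diag_mul_sub hki hk (i := 0) (by
      intro j hj; cases i <;> fin_cases j <;> first | exact absurd rfl hj | decide)
    have h2 := diag_mul_sub hki hk' (i := 0) (fun j hj => i.isIwahoriLevel'.one_le 0 j hj.symm)
    rw [← mat_mul] at h1 h2
    rw [inv_mul_cancel, mat_one, Matrix.one_apply_eq] at h2
    rw [← hx, hd] at h1
    convert h1.sub h2 using 1
    ring
  have hn00 : ‖mat D x 0 0‖ = 1 := isUnit_of_sub_one hx00
  have h00 : mat D x 0 0 ≠ 0 := by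
    intro h; rw [h, norm_zero] at hn00; exact zero_ne_one hn00
  have h00c : D.conj (mat D x 0 0) ≠ 0 := by simpa using h00
  have hdiv : ∀ (n : ℤ) (y : E), InPow D n y → InPow D n (y / mat D x 0 0) := by
    intro n y hy; unfold InPow; rwa [norm_div, hn00, div_one]
  let u : E := mat D x 1 0 / mat D x 0 0
  let w : E := mat D x 2 0 / mat D x 0 0
  have huw : u * D.conj u + w + D.conj w = 0 := by
    have h := unitaryG_rel D x 0 0
    simp [Fin.rev] at h
    simp only [u, w, map_div₀]
    field_simp
    linear_combination h
  let n := lowerUnip D u w huw (conj_conj D u)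
  have hnm : mat D n = !![1, 0, 0; u, 1, 0; w, -D.conj u, 1] := rfl
  have hu : InPow D (i.level 1 0) u := hdiv _ _ (hxK 1 0)
  have hw : InPow D (i.level 2 0) w := hdiv _ _ (hxK 2 0)
  have hn : n ∈ proIwahori' D i := by
    refine ⟨fun a b => ?_, fun a => ?_⟩
    · rw [hnm]
      fin_cases a <;> fin_cases b <;>
        first
        | exact InPow.zero _
        | exact InPow.one.mono (by cases i <;> decide)
        | exact hu.mono (by cases i <;> decide)
        | exact hw.mono (by cases i <;> decide)
        | exact hu.conj.neg.mono (by cases i <;> decide)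
    · rw [hnm]
      fin_cases a <;> simp <;> exact InPow.zero _
  obtain ⟨b, hb⟩ : ∃ b, b = n⁻¹ * x := ⟨_, rfl⟩
  have hbK : b ∈ maxK D i :=
    hb ▸ (maxK D i).mul_mem ((maxK D i).inv_mem (proIwahori'_le D i hn)) hxK
  have hxnb : x = n * b := by rw [hb]; group
  have hkb : k = k' * n * b := by rw [mul_assoc, ← hxnb, hx]; group
  have hent : ∀ a c, mat D x a c = mat D n a 0 * mat D b 0 c + mat D n a 1 * mat D b 1 c +
      mat D n a 2 * mat D b 2 c := by
    intro a c; rw [hxnb, mat_mul, Matrix.mul_apply, Fin.sum_univ_three]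
  have hb00 : mat D b 0 0 = mat D x 0 0 := by
    have := hent 0 0; simp [hnm] at this; exact this.symm
  have hb10 : mat D b 1 0 = 0 := by
    have := hent 1 0
    simp only [hnm, hb00, u] at this
    simp [h00] at this; exact this
  have hb20 : mat D b 2 0 = 0 := by
    have := hent 2 0
    simp only [hnm, hb00, hb10, w] at this
    simp [h00] at this; exact this
  have hb21 : mat D b 2 1 = 0 := by
    have := unitaryG_rel D b 0 1
    simp [Fin.rev, hb00, hb10, hb20, h00] at this; exact this
  have hb22 : InPow D 1 (mat D b 2 2 - 1) := by
    have h1 := unitaryG_rel D b 2 0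
    simp [Fin.rev, hb00, hb10, hb20] at h1
    have h2 : mat D b 2 2 - 1 = - (mat D b 2 2 * D.conj (mat D x 0 0 - 1)) := by
      rw [map_sub, map_one]; linear_combination h1
    rw [h2]
    exact (((hbK 2 2).mul hx00.conj).mono (by cases i <;> decide)).neg
  have hb11 : InPow D 1 (mat D b 1 1 - 1) := by
    obtain ⟨m, hm⟩ : ∃ m, m = k' * n := ⟨_, rfl⟩
    have hmI : m ∈ iwahori' D i := hm ▸ (iwahori' D i).mul_mem hk' hn.1
    have hkm : ∀ a c, mat D k a c = mat D m a 0 * mat D b 0 c + mat D m a 1 * mat D b 1 c +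
      mat D m a 2 * mat D b 2 c := by
      intro a c; rw [hkb, ← hm, mat_mul, Matrix.mul_apply, Fin.sum_univ_three]
    have hm10 : InPow D 1 (mat D m 1 0) := by
      have h1 := hkm 1 0
      rw [hb00, hb10, hb20] at h1
      have h2 : mat D m 1 0 = mat D k 1 0 / mat D x 0 0 := by
        field_simp; linear_combination -h1
      rw [h2]
      exact hdiv _ _ ((hk 1 0).mono (by cases i <;> decide))
    have h11 := hkm 1 1
    rw [hb21] at h11
    have h3 : InPow D 1 (mat D m 1 1 - mat D k' 1 1) := by
      have := diag_mul_sub hk' hn.1 (i := 1) (fun j hj => i.isIwahoriLevel'.one_le 1 j hj.symm)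
      rw [← mat_mul, ← hm] at this
      have h4 : mat D n 1 1 = 1 := by rw [hnm]; rfl
      rwa [h4, mul_one] at this
    have h5 : InPow D 1 (mat D m 1 0 * mat D b 0 1) :=
      (hm10.mul (hbK 0 1)).mono (by cases i <;> decide)
    have h6 : InPow D 1 (mat D k' 1 1 * (mat D b 1 1 - 1)) := by
      have h7 : InPow D 1 ((mat D m 1 1 - mat D k' 1 1) * mat D b 1 1) :=
        (h3.mul (hbK 1 1)).mono (by cases i <;> decide)
      rw [hd 1] at h11
      have h8 := (h5.add h7).neg
      convert h8 using 1
      linear_combination -h11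
    have h9 : ‖mat D k' 1 1‖ = 1 := by
      have h2 := diag_mul_sub hki hk' (i := 1) (fun j hj => i.isIwahoriLevel'.one_le 1 j hj.symm)
      rw [← mat_mul, inv_mul_cancel, mat_one, Matrix.one_apply_eq, mat_inv] at h2
      have h10 := isUnit_of_sub_one (D := D) (x := D.conj (mat D k' 1 1) * mat D k' 1 1) (by
        have := h2.neg; rwa [neg_sub] at this)
      rw [norm_mul, norm_conj] at h10
      nlinarith [norm_nonneg (mat D k' 1 1)]
    unfold InPow at h6 ⊢
    rwa [norm_mul, h9, one_mul] at h6
  refine ⟨n, hn, b, ⟨fun a c => ?_, fun a => ?_⟩, hkb⟩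
  · by_cases hac : c < a
    · have : mat D b a c = 0 := by
        revert hac
        fin_cases a <;> fin_cases c <;> intro hac <;>
          first | exact absurd hac (by decide) | exact hb10 | exact hb20 | exact hb21
      rw [this]; exact InPow.zero _
    · refine (hbK a c).mono ?_
      revert hac
      cases i <;> fin_cases a <;> fin_cases c <;> decide
  · fin_cases a
    · change InPow D 1 (mat D b 0 0 - 1); rw [hb00]; exact hx00
    · exact hb11
    · exact hb22

end Factorization

section Topology

variable {F E : Type*} [NontriviallyNormedField F] [IsUltrametricDist F] [ProperSpace F]
  [NormedField E] [NormedAlgebra F E] (D : UnramifiedQuadratic F E) (i : MaxCpt)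

theorem continuous_mat : Continuous (mat D) :=
  Units.continuous_val.comp continuous_subtype_val

theorem isOpen_maxK : IsOpen (maxK D i : Set (unitaryG D)) := by
  have : IsUltrametricDist E := IsUltrametricDist.of_normedAlgebra F
  have h : (maxK D i : Set (unitaryG D)) =
      ⋂ a, ⋂ b, (fun g => mat D g a b) ⁻¹' Metric.closedBall 0 (‖D.ϖ‖ ^ i.level a b) := by
    ext g
    simp only [Set.mem_iInter, Set.mem_preimage, mem_closedBall_zero_iff]
    rfl
  rw [h]
  refine isOpen_iInter_of_finite fun a => isOpen_iInter_of_finite fun b => ?_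
  refine (IsUltrametricDist.isOpen_closedBall _ ?_).preimage ?_
  · have := norm_ϖ_pos (D := D); positivity
  · exact ((continuous_mat D).matrix_elem a b)

theorem isClosed_unitaryG : IsClosed (unitaryG D : Set (GL (Fin 3) E)) := by
  have := finiteDim D
  have hc : Continuous D.conj := D.conj.toLinearMap.continuous_of_finiteDimensional
  have h : (unitaryG D : Set (GL (Fin 3) E)) = ⋂ v, ⋂ w,
      {g | herm D (g.1.mulVec v) (g.1.mulVec w) = herm D v w} := by
    ext g
    simp only [Set.mem_iInter]
    rfl
  rw [h]
  refine isClosed_iInter fun v => isClosed_iInter fun w => ?_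
  refine isClosed_eq ?_ continuous_const
  have hv : ∀ (v : Fin 3 → E) (a : Fin 3),
      Continuous fun g : GL (Fin 3) E => g.1.mulVec v a := fun v a =>
    (continuous_apply a).comp (Units.continuous_val.matrix_mulVec continuous_const)
  simp only [herm_apply]
  exact (((hv v 0).mul (hc.comp (hv w 2))).add ((hv v 1).mul (hc.comp (hv w 1)))).add
    ((hv v 2).mul (hc.comp (hv w 0)))

theorem isCompact_maxK : IsCompact (maxK D i : Set (unitaryG D)) := by
  have := finiteDim D
  have : ProperSpace E := FiniteDimensional.proper F E
  let S : Set (Matrix (Fin 3) (Fin 3) E) :=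
    Set.univ.pi fun a => Set.univ.pi fun b => Metric.closedBall 0 (‖D.ϖ‖ ^ i.level a b)
  have hS : IsCompact S :=
    isCompact_univ_pi fun a => isCompact_univ_pi fun b => isCompact_closedBall _ _
  have hemb := (Units.isClosedEmbedding_embedProduct (α := Matrix (Fin 3) (Fin 3) E)).comp
    (isClosed_unitaryG D).isClosedEmbedding_subtypeVal
  have hT : IsCompact (S ×ˢ (MulOpposite.op '' S)) :=
    hS.prod (hS.image MulOpposite.continuous_op)
  have hmem : ∀ g : unitaryG D, mat D g ∈ S ↔ g ∈ maxK D i := by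
    intro g
    exact ⟨fun h a b => mem_closedBall_zero_iff.1 (h a trivial b trivial),
      fun h a _ b _ => mem_closedBall_zero_iff.2 (h a b)⟩
  have hpre : (maxK D i : Set (unitaryG D)) =
      (Units.embedProduct (Matrix (Fin 3) (Fin 3) E) ∘ Subtype.val) ⁻¹'
        (S ×ˢ (MulOpposite.op '' S)) := by
    ext g
    constructor
    · intro hg
      exact ⟨(hmem g).2 hg, mat D g⁻¹, (hmem g⁻¹).2 ((maxK D i).inv_mem hg), rfl⟩
    · intro hg
      exact (hmem g).1 hg.1
  rw [hpre]
  exact hemb.isCompact_preimage hT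

end Topology

section Induction

variable {k G W : Type*} [Field k] [Group G] [TopologicalSpace G] [IsTopologicalGroup G]
  [AddCommGroup W] [Module k W] {K : Subgroup G} (σ : Representation k K W)

/-- A representation is smooth if all stabilizers of vectors are open. -/
def IsSmooth {H : Type*} [Group H] [TopologicalSpace H] (ρ : Representation k H W) : Prop :=
  ∀ w : W, IsOpen {h : H | ρ h w = w}

/-- The space `S(G, σ)` of all locally constant functions `f : G → W` with compact support such
that `f (κ g) = σ(κ) f(g)` for `κ ∈ K`. -/
def indSpace : Submodule k (G → W) where
  carrier := {f | (∀ (κ : K) (g : G), f (κ * g) = σ κ (f g)) ∧ IsLocallyConstant f ∧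
    HasCompactSupport f}
  zero_mem' := ⟨fun κ g => by simp, IsLocallyConstant.const 0, HasCompactSupport.zero⟩
  add_mem' := by
    intro f₁ f₂ h₁ h₂
    exact ⟨fun κ g => by simp [h₁.1, h₂.1], h₁.2.1.add h₂.2.1, h₁.2.2.add h₂.2.2⟩
  smul_mem' := by
    intro c f h
    exact ⟨fun κ g => by simp [h.1], h.2.1.comp (fun w => c • w),
      h.2.2.comp_left (g := fun w => c • w) (smul_zero c)⟩

/-- The compactly induced representation `ind_K^G σ`: `G` acts on `S(G, σ)` by right
translation. -/
def ind : Representation k G (indSpace σ) where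
  toFun g :=
    { toFun := fun f => ⟨fun x => f.1 (x * g),
          fun κ x => (congrArg f.1 (mul_assoc _ _ _)).trans (f.2.1 κ (x * g)),
        f.2.2.1.comp_continuous (continuous_mul_const g),
        f.2.2.2.comp_homeomorph (Homeomorph.mulRight g)⟩
      map_add' := fun _ _ => rfl
      map_smul' := fun _ _ => rfl }
  map_one' := by ext f x; simp
  map_mul' := by intro g h; ext f x; simp [mul_assoc]

/-- The convolution `(φ * f)(g) = ∑_{y ∈ G / K} φ(y) f(y⁻¹ g)`. -/
noncomputable def conv (K : Subgroup G) (φ : G → Module.End k W) (f : G → W) (g : G) : W :=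
  ∑ᶠ y : G ⧸ K, φ y.out (f (y.out⁻¹ * g))

/-- `φ(κ g κ') = σ(κ) φ(g) σ(κ')` for `κ, κ' ∈ K`. -/
def IsBiequivariant (φ : G → Module.End k W) : Prop :=
  ∀ (κ : K) (g : G) (κ' : K), φ (κ * g * κ') = σ κ * φ g * σ κ'

variable {σ}

theorem finite_cosets {φ : G → Module.End k W} (hK : IsOpen (K : Set G)) {C : Set G} (hC : IsCompact C) (hφC : ∀ g, φ g ≠ 0 → g ∈ C) :
    {y : G ⧸ K | φ y.out ≠ 0}.Finite := by
  have : DiscreteTopology (G ⧸ K) := QuotientGroup.discreteTopology hK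
  refine ((hC.image (QuotientGroup.continuous_mk (N := K))).finite_of_discrete).subset ?_
  intro y hy
  exact ⟨y.out, hφC _ hy, y.out_eq⟩

theorem conv_eq_sum {φ : G → Module.End k W} (hfin : {y : G ⧸ K | φ y.out ≠ 0}.Finite)
    (f : G → W) (g : G) :
    conv K φ f g = ∑ y ∈ hfin.toFinset, φ y.out (f (y.out⁻¹ * g)) := by
  refine finsum_eq_sum_of_support_subset _ ?_
  intro y hy
  simp only [Set.Finite.coe_toFinset]
  intro h
  apply hy
  simp [h]

theorem conv_term {φ : G → Module.End k W} (hφ : IsBiequivariant σ φ) (f : indSpace σ) (g x : G) :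
    φ (x : G ⧸ K).out (f.1 ((x : G ⧸ K).out⁻¹ * g)) = φ x (f.1 (x⁻¹ * g)) := by
  obtain ⟨κ, hκ⟩ := QuotientGroup.mk_out_eq_mul K x
  rw [hκ]
  have h1 : φ (x * κ) = φ x * σ κ := by
    have := hφ 1 x κ; simpa using this
  have h2 : f.1 ((x * κ)⁻¹ * g) = σ κ⁻¹ (f.1 (x⁻¹ * g)) := by
    rw [← f.2.1]; simp [mul_assoc]
  rw [h1, h2, Module.End.mul_apply, ← Module.End.mul_apply (σ κ), ← map_mul]
  simp

theorem conv_mem {φ : G → Module.End k W} (hφ : IsBiequivariant σ φ)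
    (hfin : {y : G ⧸ K | φ y.out ≠ 0}.Finite) (f : indSpace σ) : conv K φ f.1 ∈ indSpace σ := by
  refine ⟨fun κ g => ?_, ?_⟩
  · have h1 : conv K φ f.1 (κ * g) =
        ∑ᶠ y : G ⧸ K, σ κ (φ y.out (f.1 (y.out⁻¹ * g))) := by
      unfold conv
      rw [← finsum_comp_equiv (MulAction.toPerm (κ : G))]
      congr 1
      ext y
      have h2 : (MulAction.toPerm (κ : G)) y = (((κ : G) * y.out : G) : G ⧸ K) := by
        rw [MulAction.toPerm_apply]
        conv_lhs => rw [← y.out_eq]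
        rfl
      rw [h2, conv_term hφ]
      have h3 : φ (κ * y.out) = σ κ * φ y.out := by
        have := hφ κ y.out 1; simpa using this
      rw [h3, Module.End.mul_apply]
      congr 3
      group
    rw [h1, conv, map_finsum]
    refine hfin.subset ?_
    intro y hy h
    apply hy
    simp [h]
  · have h : conv K φ f.1 = ∑ y ∈ hfin.toFinset, fun g => φ y.out (f.1 (y.out⁻¹ * g)) := by
      ext g
      rw [conv_eq_sum hfin, Finset.sum_apply]
    rw [h]
    refine Finset.sum_induction _ (fun F : G → W => IsLocallyConstant F ∧ HasCompactSupport F)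
      (fun _ _ h₁ h₂ => ⟨h₁.1.add h₂.1, h₁.2.add h₂.2⟩)
      ⟨IsLocallyConstant.const 0, HasCompactSupport.zero⟩ ?_
    intro y _
    exact ⟨(f.2.2.1.comp_continuous (continuous_const_mul y.out⁻¹)).comp (φ y.out),
      (f.2.2.2.comp_homeomorph (Homeomorph.mulLeft y.out⁻¹)).comp_left (map_zero _)⟩

/-- The endomorphism `f ↦ φ * f` of `ind_K^G σ`, an element of the spherical Hecke algebra
`End_G (ind_K^G σ)`. -/
noncomputable def convEnd (φ : G → Module.End k W) (hφ : IsBiequivariant σ φ)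
    (hfin : {y : G ⧸ K | φ y.out ≠ 0}.Finite) :
    Representation.IntertwiningMap (ind σ) (ind σ) where
  toFun f := ⟨conv K φ f.1, conv_mem hφ hfin f⟩
  map_add' f₁ f₂ := by
    ext g
    simp [conv_eq_sum hfin, Finset.sum_add_distrib]
  map_smul' c f := by
    ext g
    simp [conv_eq_sum hfin, Finset.smul_sum]
  isIntertwining' g := by
    ext f x
    simp [ind, conv, mul_assoc]

end Induction

section Hecke

variable {F E : Type*} [NontriviallyNormedField F] [IsUltrametricDist F] [ProperSpace F]
  [NormedField E] [NormedAlgebra F E] {D : UnramifiedQuadratic F E} {i : MaxCpt}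
  {k W : Type*} [Field k] [AddCommGroup W] [Module k W] (σ : Representation k (maxK D i) W)

/-- The restriction of `σ` to `I_{1,K}`. -/
def resPro : Representation k ((proIwahori D i).subgroupOf (maxK D i)) W :=
  σ.comp ((proIwahori D i).subgroupOf (maxK D i)).subtype

/-- The restriction of `σ` to `I'_{1,K}`. -/
def resPro' : Representation k ((proIwahori' D i).subgroupOf (maxK D i)) W :=
  σ.comp ((proIwahori' D i).subgroupOf (maxK D i)).subtype

/-- The composition `σ^{I_{1,K}} ↪ σ ↠ σ_{I'_{1,K}}`. -/
noncomputable def invToCoinv : (resPro σ).invariants →ₗ[k] (resPro' σ).Coinvariants :=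
  Representation.Coinvariants.mk (resPro' σ) ∘ₗ (resPro σ).invariants.subtype

open Classical in
/-- The map `j_σ : σ ↠ σ_{I'_{1,K}} ≃ σ^{I_{1,K}} ⊆ σ`, where the isomorphism is the inverse of
`invToCoinv σ`. For an irreducible smooth `σ` in characteristic `p`, `invToCoinv σ` is an
isomorphism, so that the first alternative holds. -/
noncomputable def jMap : Module.End k W :=
  if h : Function.Bijective (invToCoinv σ) then
    (resPro σ).invariants.subtype ∘ₗ (LinearEquiv.ofBijective (invToCoinv σ) h).symm.toLinearMap ∘ₗ
      Representation.Coinvariants.mk (resPro' σ)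
  else 0

open Classical in
/-- The function `φ` on `G` supported on `K α K` with
`φ(κ α κ') = σ(κ) j_σ σ(κ')` for `κ, κ' ∈ K`. -/
noncomputable def heckeFun (g : unitaryG D) : Module.End k W :=
  if h : ∃ q : maxK D i × maxK D i, g = q.1 * alpha D * q.2 then
    σ h.choose.1 * jMap σ * σ h.choose.2
  else 0

theorem sub_mem_ker' {u : unitaryG D} (hu : u ∈ proIwahori' D i) (w : W) :
    σ ⟨u, proIwahori'_le D i hu⟩ w - w ∈ Representation.Coinvariants.ker (resPro' σ) :=
  Representation.Coinvariants.sub_mem_ker (ρ := resPro' σ)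
    ⟨⟨u, proIwahori'_le D i hu⟩, Subgroup.mem_subgroupOf.2 hu⟩ w

theorem map_ker' {κ : maxK D i} (hκ : (κ : unitaryG D) ∈ iwahori' D i) {w : W}
    (hw : w ∈ Representation.Coinvariants.ker (resPro' σ)) :
    σ κ w ∈ Representation.Coinvariants.ker (resPro' σ) := by
  unfold Representation.Coinvariants.ker at hw
  induction hw using Submodule.span_induction with
  | mem x hx =>
    obtain ⟨⟨u, v⟩, rfl⟩ := hx
    have hu : κ * (u.1 : unitaryG D) * (κ : unitaryG D)⁻¹ ∈ proIwahori' D i :=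
      levelGroup₁_conj hκ (Subgroup.mem_subgroupOf.1 u.2)
    have h := sub_mem_ker' σ hu (σ κ v)
    convert h using 1
    rw [map_sub]
    congr 1
    change σ κ (σ u.1 v) = _
    rw [← Module.End.mul_apply, ← Module.End.mul_apply, ← map_mul, ← map_mul]
    congr 2
    ext1
    simp
  | zero => simp
  | add x y _ _ hx hy => rw [map_add]; exact add_mem hx hy
  | smul a x _ hx => rw [map_smul]; exact Submodule.smul_mem _ _ hx

theorem jMap_comm {κ κ' : maxK D i} (h : (κ : unitaryG D) * alpha D = alpha D * κ') :
    σ κ * jMap σ = jMap σ * σ κ' := by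
  by_cases hb : Function.Bijective (invToCoinv σ)
  swap
  · simp [jMap, hb]
  obtain ⟨hκ, hκ', hd⟩ := mem_iwahori_of_alpha κ.2 κ'.2 h
  ext w
  let e := LinearEquiv.ofBijective (invToCoinv σ) hb
  let m := Representation.Coinvariants.mk (resPro' σ)
  have hj : ∀ w, jMap σ w = (e.symm (m w) : W) := by intro w; simp [jMap, hb, e, m]
  have hm : ∀ x y : W, m x = m y ↔ x - y ∈ Representation.Coinvariants.ker (resPro' σ) :=
    fun x y => Representation.Coinvariants.mk_eq_iff (ρ := resPro' σ)
  obtain ⟨v, hv⟩ : ∃ v, v = e.symm (m w) := ⟨_, rfl⟩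
  have hvw : m v = m w := by
    have : e v = m w := by rw [hv, LinearEquiv.apply_symm_apply]
    exact this
  have hinv : σ κ v ∈ (resPro σ).invariants := by
    intro u
    have hu : (κ : unitaryG D)⁻¹ * (u.1 : unitaryG D) * κ ∈ proIwahori D i := by
      have := levelGroup₁_conj ((iwahori D i).inv_mem hκ) (Subgroup.mem_subgroupOf.1 u.2)
      rwa [inv_inv] at this
    have h1 := v.2 ⟨⟨_, proIwahori_le D i hu⟩, Subgroup.mem_subgroupOf.2 hu⟩
    change σ ⟨_, proIwahori_le D i hu⟩ (v : W) = v at h1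
    change σ u.1 (σ κ v) = σ κ v
    conv_rhs => rw [← h1]
    rw [← Module.End.mul_apply, ← Module.End.mul_apply, ← map_mul, ← map_mul]
    congr 2
    ext1
    simp [mul_assoc]
  rw [Module.End.mul_apply, Module.End.mul_apply, hj, hj, ← hv]
  have key : e ⟨σ κ v, hinv⟩ = m (σ κ' w) := by
    change m (σ κ v) = m (σ κ' w)
    obtain ⟨n, hn, b, hbI, hnb⟩ := exists_factor hκ hκ' hd
    have h1 : σ κ v = σ κ' (σ ⟨n, proIwahori'_le D i hn⟩ v) := by
      have h2 := v.2 ⟨⟨b, proIwahori_le D i hbI⟩, Subgroup.mem_subgroupOf.2 hbI⟩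
      change σ ⟨b, proIwahori_le D i hbI⟩ (v : W) = v at h2
      conv_rhs => rw [← h2]
      rw [← Module.End.mul_apply, ← Module.End.mul_apply, ← map_mul, ← map_mul]
      congr 2
      ext1
      rw [hnb]
      simp [mul_assoc]
    rw [h1, hm, ← map_sub]
    apply map_ker' σ hκ'
    have h3 := add_mem (sub_mem_ker' σ hn (v : W)) ((hm _ _).1 hvw)
    rwa [sub_add_sub_cancel] at h3
  rw [← key, LinearEquiv.symm_apply_apply]

theorem heckeFun_apply (κ κ' : maxK D i) :
    heckeFun σ (κ * alpha D * κ') = σ κ * jMap σ * σ κ' := by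
  have h : ∃ q : maxK D i × maxK D i, (κ * alpha D * κ' : unitaryG D) = q.1 * alpha D * q.2 :=
    ⟨(κ, κ'), rfl⟩
  rw [heckeFun, dif_pos h]
  have hs := h.choose_spec
  generalize h.choose = q at hs
  have h1 : ((q.1⁻¹ * κ : maxK D i) : unitaryG D) * alpha D =
      alpha D * ((q.2 * κ'⁻¹ : maxK D i) : unitaryG D) := by
    push_cast
    calc (q.1 : unitaryG D)⁻¹ * κ * alpha D
        = (q.1 : unitaryG D)⁻¹ * (κ * alpha D * κ') * (κ' : unitaryG D)⁻¹ := by group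
      _ = alpha D * (q.2 * (κ' : unitaryG D)⁻¹) := by rw [hs]; group
  have h2 := jMap_comm σ h1
  calc σ q.1 * jMap σ * σ q.2
      = σ q.1 * (jMap σ * σ (q.2 * κ'⁻¹)) * σ κ' := by
        rw [mul_assoc, mul_assoc, mul_assoc, ← map_mul]; simp
    _ = σ κ * jMap σ * σ κ' := by
        rw [← h2, ← mul_assoc, ← map_mul]; simp

theorem heckeFun_biequivariant : IsBiequivariant σ (heckeFun σ) := by
  intro κ g κ'
  by_cases h : ∃ q : maxK D i × maxK D i, g = q.1 * alpha D * q.2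
  · obtain ⟨q, rfl⟩ := h
    have h1 : (κ * (q.1 * alpha D * q.2) * κ' : unitaryG D) =
        ((κ * q.1 : maxK D i) : unitaryG D) * alpha D * ((q.2 * κ' : maxK D i) : unitaryG D) := by
      push_cast; group
    rw [h1, heckeFun_apply, heckeFun_apply, map_mul, map_mul]
    simp only [mul_assoc]
  · have h1 : ¬ ∃ q : maxK D i × maxK D i,
        (κ * g * κ' : unitaryG D) = q.1 * alpha D * q.2 := by
      rintro ⟨q, hq⟩
      refine h ⟨(κ⁻¹ * q.1, q.2 * κ'⁻¹), ?_⟩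
      push_cast
      calc g = (κ : unitaryG D)⁻¹ * (κ * g * κ') * (κ' : unitaryG D)⁻¹ := by group
        _ = _ := by rw [hq]; group
    rw [heckeFun, dif_neg h1, heckeFun, dif_neg h]
    simp

theorem heckeFun_finite : {y : unitaryG D ⧸ maxK D i | heckeFun σ y.out ≠ 0}.Finite := by
  have hK := isCompact_maxK D i
  refine finite_cosets (isOpen_maxK D i)
    ((hK.mul (isCompact_singleton (x := alpha D))).mul hK) ?_
  intro g hg
  by_contra hne
  apply hg
  rw [heckeFun, dif_neg]
  rintro ⟨q, hq⟩
  exact hne ⟨_, ⟨_, q.1.2, _, rfl, rfl⟩, _, q.2.2, hq.symm⟩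

/-- The Hecke operator `T ∈ End_G (ind_K^G σ)` given by convolution with `φ`. -/
noncomputable def heckeT : Representation.IntertwiningMap (ind σ) (ind σ) :=
  convEnd (heckeFun σ) (heckeFun_biequivariant σ) (heckeFun_finite σ)

/-- The image `(P(T))` of the endomorphism `P(T)` of `ind_K^G σ`. -/
noncomputable def heckeIdeal (P : Polynomial k) : Submodule k (indSpace σ) :=
  LinearMap.range (Polynomial.aeval (heckeT σ) P).toLinearMap

/-- The spherical universal Hecke module `π = ind_K^G σ / (P(T))`. -/
noncomputable def heckeModule (P : Polynomial k) :
    Representation k (unitaryG D) (indSpace σ ⧸ heckeIdeal σ P) :=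
  (ind σ).quotient (heckeIdeal σ P) (by
    rintro g _ ⟨f, rfl⟩
    exact ⟨ind σ g f,
      Representation.IntertwiningMap.isIntertwining _ _ (Polynomial.aeval (heckeT σ) P) g f⟩)

/-- The functions in `ind_K^G σ` with support in `S`. -/
def supportedIn (S : Set (unitaryG D)) : Submodule k (indSpace σ) where
  carrier := {f | ∀ g, f.1 g ≠ 0 → g ∈ S}
  zero_mem' := fun _ h => absurd rfl h
  add_mem' := by
    intro f₁ f₂ h₁ h₂ g hg
    by_contra hS
    exact hg (by
      change f₁.1 g + f₂.1 g = 0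
      rw [not_not.1 (mt (h₁ g) hS), not_not.1 (mt (h₂ g) hS), add_zero])
  smul_mem' := by
    intro c f h g hg
    exact h g fun h0 => hg (by change c • f.1 g = 0; rw [h0, smul_zero])

/-- The double coset `K g I_K`. -/
def doubleCoset (i : MaxCpt) (g : unitaryG D) : Set (unitaryG D) :=
  {x | ∃ κ ∈ maxK D i, ∃ b ∈ iwahori D i, x = κ * g * b}

/-- `R_n^+(σ)`, the functions supported in `K α^n I_K`. -/
def rPlus (n : ℕ) : Submodule k (indSpace σ) := supportedIn σ (doubleCoset i (alpha D ^ n))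

/-- `R_n^-(σ)`, the functions supported in `K α^{-(n+1)} I_K`. -/
def rMinus (n : ℕ) : Submodule k (indSpace σ) :=
  supportedIn σ (doubleCoset i (alpha D ^ (-((n : ℤ) + 1))))

/-- `I^+(σ) = ⨁_{n ≥ 0} R_n^+(σ)`. -/
def iPlus : Submodule k (indSpace σ) := ⨆ n : ℕ, rPlus σ n

/-- `I^-(σ) = ⨁_{n ≥ 0} R_n^-(σ)`. -/
def iMinus : Submodule k (indSpace σ) := ⨆ n : ℕ, rMinus σ n

/-- `I^+(σ, π)`, the image of `I^+(σ)` in `π = ind_K^G σ / (P(T))`. -/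
noncomputable def iPlusImage (P : Polynomial k) : Submodule k (indSpace σ ⧸ heckeIdeal σ P) :=
  (iPlus σ).map (heckeIdeal σ P).mkQ

/-- `I^-(σ, π)`, the image of `I^-(σ)` in `π = ind_K^G σ / (P(T))`. -/
noncomputable def iMinusImage (P : Polynomial k) : Submodule k (indSpace σ ⧸ heckeIdeal σ P) :=
  (iMinus σ).map (heckeIdeal σ P).mkQ

/-- The invariants `π^H` of a subgroup `H` of `G`. -/
noncomputable def invariantsOf {G V : Type*} [Group G] [AddCommGroup V] [Module k V]
    (π : Representation k G V) (H : Subgroup G) : Submodule k V :=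
  Representation.invariants (π.comp H.subtype)

end Hecke

end U21

/-!
The idea is that the Hecke operator `T` respects the decomposition `ind_K^G σ = I⁺(σ) ⊕ I⁻(σ)` up to
`I_{1,K}`-invariant functions. In the tree of `G`, the group `I_K` fixes an edge, `I⁺(σ)` and
`I⁻(σ)` consist of the functions supported on the two half trees, and `T` moves the support by
distance exactly two. Hence `T` carries something across the edge only from `R_0^+(σ)` to `R_0^-(σ)`
and from `R_0^-(σ)` to `R_0^+(σ)`, and in both cases the result is `I_{1,K}`-invariant
(`heckeT_mul_right`): in the first because `j_σ` factors through the `I'_{1,K}`-coinvariants and the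
Weyl element `s` of `K`, with `s α s = α⁻¹`, conjugates `I_{1,K}` into `I'_{1,K}`; in the second
because `j_σ` takes values in `σ^{I_{1,K}}`. As `T` commutes with `G`, every polynomial in `T`
therefore maps `I^±(σ)` into `I^±(σ) + (ind_K^G σ)^{I_{1,K}}` (`aeval_heckeT_mem`).

Now let `f₁ ∈ I⁺(σ)` and `f₂ ∈ I⁻(σ)` have the same image in `π`, and write
`f₁ - f₂ = P(T)(h₁ + h₂)` with `h₁ ∈ I⁺(σ)`, `h₂ ∈ I⁻(σ)`, and `P(T) hᵢ = aᵢ + cᵢ` with `a₁ ∈ I⁺(σ)`,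
`a₂ ∈ I⁻(σ)` and `cᵢ` invariant. Then `(f₁ - a₁) - (f₂ + a₂)` is invariant. The two halves are
stable under `I_{1,K}` and meet in `0`, so `f₁ - a₁` is invariant itself; and `f₁` has the same image
in `π` as `f₁ - a₁ - c₁`.

The geometry of the tree is replaced by norms of columns of matrices. For a lattice norm on `E³`
preserved by `K`, the norms `colNorm` of the columns of `g` depend on `K g` only, change by at most
a factor `‖ϖ‖^{±1}` under `K α K`, and `g ∈ K αⁿ I_K` with `n ≥ 0` if and only if the first column
is at least as long as the last one (`mem_plusSide_iff`). That the double cosets `K αⁿ I_K` cover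
`G` (`exists_mem_doubleCoset`) is elimination with the largest entry of the longer of these two
columns as pivot. That column is isotropic, so the pivot can be taken in the first or last row.
-/

namespace U21

/-! ### The value group of `E` -/

section Valuation

variable {F E : Type*} [NontriviallyNormedField F] [NormedField E] [NormedAlgebra F E]
  {D : UnramifiedQuadratic F E}

theorem zpow_norm_ϖ_le_iff {m n : ℤ} : ‖D.ϖ‖ ^ m ≤ ‖D.ϖ‖ ^ n ↔ n ≤ m :=
  zpow_le_zpow_iff_right_of_lt_one₀ norm_ϖ_pos D.norm_ϖ_lt_one

theorem zpow_norm_ϖ_lt_iff {m n : ℤ} : ‖D.ϖ‖ ^ m < ‖D.ϖ‖ ^ n ↔ n < m :=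
  zpow_lt_zpow_iff_right_of_lt_one₀ norm_ϖ_pos D.norm_ϖ_lt_one

theorem norm_zpow_ϖ (n : ℤ) : ‖algebraMap F E D.ϖ ^ n‖ = ‖D.ϖ‖ ^ n := by
  rw [norm_zpow, norm_algebraMap']

/-- The value group of `E` is generated by `‖ϖ‖`. -/
theorem exists_norm_eq_zpow (D : UnramifiedQuadratic F E) {x : E} (hx : x ≠ 0) :
    ∃ n : ℤ, ‖x‖ = ‖D.ϖ‖ ^ n := by
  have hr := norm_ϖ_pos (D := D)
  obtain ⟨n, h1, h2⟩ := exists_mem_Ioc_zpow (norm_pos_iff.2 hx)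
    ((one_lt_inv₀ hr).2 D.norm_ϖ_lt_one)
  rw [inv_zpow'] at h1 h2
  refine ⟨-(n + 1), le_antisymm h2 ?_⟩
  by_contra! h3
  have h4 : ‖x * algebraMap F E D.ϖ ^ (n + 1)‖ < 1 := by
    rw [norm_mul, norm_zpow_ϖ]
    calc _ < ‖D.ϖ‖ ^ (-(n + 1)) * ‖D.ϖ‖ ^ (n + 1) := by gcongr
      _ = 1 := by rw [← zpow_add₀ hr.ne']; simp
  have h5 := D.norm_le_norm_ϖ _ h4
  rw [norm_mul, norm_zpow_ϖ] at h5
  refine h1.not_ge ?_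
  calc ‖x‖ = ‖x‖ * ‖D.ϖ‖ ^ (n + 1) * ‖D.ϖ‖ ^ (-(n + 1)) := by
        rw [mul_assoc, ← zpow_add₀ hr.ne']; simp
    _ ≤ ‖D.ϖ‖ * ‖D.ϖ‖ ^ (-(n + 1)) := by gcongr
    _ = ‖D.ϖ‖ ^ (-n) := by
        rw [← zpow_one_add₀ hr.ne']; congr 1; ring

theorem inPow_of_norm_sq_le {n m : ℤ} {x : E} (h : ‖x‖ ^ 2 ≤ ‖D.ϖ‖ ^ n) (hm : 2 * m - 1 ≤ n) :
    InPow D m x := by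
  by_cases hx : x = 0
  · rw [hx]; exact InPow.zero m
  obtain ⟨l, hl⟩ := exists_norm_eq_zpow D hx
  rw [hl, ← zpow_natCast, ← zpow_mul, zpow_norm_ϖ_le_iff] at h
  unfold InPow
  rw [hl, zpow_norm_ϖ_le_iff]
  push_cast at h
  omega

theorem inPow_zpow_mul {n m : ℤ} {x : E} (hx : InPow D n x) :
    InPow D (m + n) (algebraMap F E D.ϖ ^ m * x) :=
  InPow.mul (norm_zpow_ϖ m).le hx

theorem unitaryG_ext {g h : unitaryG D} (H : ∀ a b, mat D g a b = mat D h a b) : g = h :=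
  Subtype.ext (Units.ext (Matrix.ext H))

end Valuation

/-! ### The elements `α` and `s` of `G` -/

section Elements

variable {F E : Type*} [NontriviallyNormedField F] [NormedField E] [NormedAlgebra F E]
  {D : UnramifiedQuadratic F E}

theorem mat_alpha_mul (g : unitaryG D) (a b : Fin 3) :
    mat D (alpha D * g) a b = algebraMap F E D.ϖ ^ ((a : ℤ) - 1) * mat D g a b := by
  rw [mat_mul]
  change (Matrix.diagonal ![(algebraMap F E D.ϖ)⁻¹, 1, algebraMap F E D.ϖ] * mat D g) a b = _
  rw [Matrix.diagonal_mul]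
  fin_cases a <;> simp

theorem mat_alpha_zpow_mul (n : ℤ) (g : unitaryG D) (a b : Fin 3) :
    mat D (alpha D ^ n * g) a b = algebraMap F E D.ϖ ^ (n * ((a : ℤ) - 1)) * mat D g a b := by
  have hϖ := ϖ_ne_zero' D
  induction n using Int.induction_on with
  | zero => simp
  | succ n ih =>
    rw [add_comm, zpow_one_add, mul_assoc, mat_alpha_mul, ih, ← mul_assoc, ← zpow_add₀ hϖ]
    congr 2; ring
  | pred n ih =>
    have h := mat_alpha_mul (alpha D ^ (-(n : ℤ) - 1) * g) a b
    rw [← mul_assoc, ← zpow_one_add, show 1 + (-(n : ℤ) - 1) = -n by ring, ih] at h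
    apply mul_left_cancel₀ (zpow_ne_zero ((a : ℤ) - 1) hϖ)
    rw [← h, ← mul_assoc, ← zpow_add₀ hϖ]
    congr 2; ring

/-- The exponent `c` for which `K` has level `-c` in the upper right corner. -/
def MaxCpt.corner : MaxCpt → ℤ
  | .K₀ => 0
  | .K₁ => 1

/-- The element of `K` with antidiagonal entries `ϖ⁻ᶜ, 1, ϖᶜ`, which represents the nontrivial
Weyl group element. -/
def weyl (D : UnramifiedQuadratic F E) (i : MaxCpt) : unitaryG D :=
  ⟨⟨!![0, 0, algebraMap F E D.ϖ ^ (-i.corner); 0, 1, 0; algebraMap F E D.ϖ ^ i.corner, 0, 0],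
    !![0, 0, algebraMap F E D.ϖ ^ (-i.corner); 0, 1, 0; algebraMap F E D.ϖ ^ i.corner, 0, 0],
    by
      have := zpow_ne_zero i.corner (ϖ_ne_zero' D)
      ext a b
      fin_cases a <;> fin_cases b <;>
        simp [Matrix.mul_apply, Fin.sum_univ_three, this],
    by
      have := zpow_ne_zero i.corner (ϖ_ne_zero' D)
      ext a b
      fin_cases a <;> fin_cases b <;>
        simp [Matrix.mul_apply, Fin.sum_univ_three, this]⟩, by
    have := zpow_ne_zero i.corner (ϖ_ne_zero' D)
    apply mem_unitaryG_of_rel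
    intro a b
    fin_cases a <;> fin_cases b <;> simp [Fin.rev, this]⟩

variable {i : MaxCpt}

theorem weyl_mul_weyl : weyl D i * weyl D i = 1 :=
  Subtype.ext (Units.ext (weyl D i).1.val_inv)

theorem mat_weyl_mul (g : unitaryG D) (a b : Fin 3) :
    mat D (weyl D i * g) a b =
      algebraMap F E D.ϖ ^ (((a : ℤ) - 1) * i.corner) * mat D g a.rev b := by
  rw [mat_mul, Matrix.mul_apply, Fin.sum_univ_three]
  change !![0, 0, algebraMap F E D.ϖ ^ (-i.corner); 0, 1, 0; algebraMap F E D.ϖ ^ i.corner, 0, 0]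
    a 0 * _ + !![0, 0, algebraMap F E D.ϖ ^ (-i.corner); 0, 1, 0;
    algebraMap F E D.ϖ ^ i.corner, 0, 0] a 1 * _ + !![0, 0, algebraMap F E D.ϖ ^ (-i.corner);
    0, 1, 0; algebraMap F E D.ϖ ^ i.corner, 0, 0] a 2 * _ = _
  fin_cases a <;> simp [Fin.rev]

theorem mat_mul_weyl (g : unitaryG D) (a b : Fin 3) :
    mat D (g * weyl D i) a b =
      algebraMap F E D.ϖ ^ ((1 - (b : ℤ)) * i.corner) * mat D g a b.rev := by
  rw [mat_mul, Matrix.mul_apply, Fin.sum_univ_three]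
  change _ * !![0, 0, algebraMap F E D.ϖ ^ (-i.corner); 0, 1, 0;
    algebraMap F E D.ϖ ^ i.corner, 0, 0] 0 b + _ * !![0, 0, algebraMap F E D.ϖ ^ (-i.corner);
    0, 1, 0; algebraMap F E D.ϖ ^ i.corner, 0, 0] 1 b + _ * !![0, 0,
    algebraMap F E D.ϖ ^ (-i.corner); 0, 1, 0; algebraMap F E D.ϖ ^ i.corner, 0, 0] 2 b = _
  fin_cases b <;> simp [Fin.rev, mul_comm]

theorem mat_weyl_conj (g : unitaryG D) (a b : Fin 3) :
    mat D (weyl D i * g * weyl D i) a b =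
      algebraMap F E D.ϖ ^ (((a : ℤ) - b) * i.corner) * mat D g a.rev b.rev := by
  rw [mat_mul_weyl, mat_weyl_mul, ← mul_assoc, ← zpow_add₀ (ϖ_ne_zero' D)]
  congr 2; ring

theorem weyl_mul_alpha_zpow (n : ℤ) :
    weyl D i * alpha D ^ n = alpha D ^ (-n) * weyl D i := by
  refine unitaryG_ext fun a b => ?_
  rw [← mul_one (alpha D ^ n), ← mul_one (weyl D i), mul_assoc, one_mul, mat_weyl_mul,
    mat_alpha_zpow_mul, mat_alpha_zpow_mul, mat_weyl_mul, mul_left_comm]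
  congr 2
  have h : ((a.rev : ℕ) : ℤ) = 2 - (a : ℕ) := by fin_cases a <;> rfl
  rw [h]
  ring

end Elements

/-! ### Norms of columns -/

section ColumnNorm

/-- The exponents `w` of the sup norm `max ‖x a‖ ‖ϖ‖ ^ w a` on `E³`, which is preserved by `K`: its
unit ball is the `K`-stable lattice `𝔬_E ⊕ 𝔬_E ⊕ 𝔭_Eᶜ`. -/
def MaxCpt.weight (i : MaxCpt) : Fin 3 → ℤ := ![0, 0, -i.corner]

variable {F E : Type*} [NontriviallyNormedField F] [IsUltrametricDist F] [ProperSpace F]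
  [NormedField E] [NormedAlgebra F E] {D : UnramifiedQuadratic F E} {i : MaxCpt}

/-- The norm of the `j`-th column of `g`, for the sup norm on `E³` with exponents `i.weight`,
normalized such that `1` has columns of norm `1`. -/
noncomputable def colNorm (i : MaxCpt) (g : unitaryG D) (j : Fin 3) : ℝ :=
  Finset.univ.sup' Finset.univ_nonempty fun a =>
    ‖mat D g a j‖ * ‖D.ϖ‖ ^ (i.weight a - i.weight j)

theorem le_colNorm (g : unitaryG D) (a j : Fin 3) :
    ‖mat D g a j‖ * ‖D.ϖ‖ ^ (i.weight a - i.weight j) ≤ colNorm i g j :=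
  Finset.le_sup' (fun a => ‖mat D g a j‖ * ‖D.ϖ‖ ^ (i.weight a - i.weight j)) (Finset.mem_univ a)

theorem colNorm_le_zpow_iff {g : unitaryG D} {j : Fin 3} {m : ℤ} :
    colNorm i g j ≤ ‖D.ϖ‖ ^ m ↔
      ∀ a, InPow D (m + i.weight j - i.weight a) (mat D g a j) := by
  have hr := norm_ϖ_pos (D := D)
  simp only [colNorm, Finset.sup'_le_iff, Finset.mem_univ, true_implies]
  refine forall_congr' fun a => ?_
  unfold InPow
  rw [← le_div_iff₀ (by positivity), ← zpow_sub₀ hr.ne']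
  congr! 2
  ring

theorem exists_mat_ne_zero (g : unitaryG D) (j : Fin 3) : ∃ a, mat D g a j ≠ 0 := by
  by_contra! h
  have h1 : mat D (g⁻¹ * g) j j = 0 := by
    rw [mat_mul, Matrix.mul_apply]
    exact Finset.sum_eq_zero fun a _ => by rw [h, mul_zero]
  rw [inv_mul_cancel, mat_one, Matrix.one_apply_eq] at h1
  exact one_ne_zero h1

theorem colNorm_pos (g : unitaryG D) (j : Fin 3) : 0 < colNorm i g j := by
  have hr := norm_ϖ_pos (D := D)
  obtain ⟨a, ha⟩ := exists_mat_ne_zero g j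
  have := norm_pos_iff.2 ha
  exact lt_of_lt_of_le (by positivity) (le_colNorm g a j)

theorem exists_colNorm_eq_entry (i : MaxCpt) (g : unitaryG D) (j : Fin 3) :
    ∃ a, colNorm i g j = ‖mat D g a j‖ * ‖D.ϖ‖ ^ (i.weight a - i.weight j) := by
  obtain ⟨a, -, ha⟩ := Finset.exists_mem_eq_sup' (Finset.univ_nonempty (α := Fin 3)) fun a =>
    ‖mat D g a j‖ * ‖D.ϖ‖ ^ (i.weight a - i.weight j)
  exact ⟨a, ha⟩

theorem exists_colNorm_eq_zpow (i : MaxCpt) (g : unitaryG D) (j : Fin 3) :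
    ∃ m : ℤ, colNorm i g j = ‖D.ϖ‖ ^ m := by
  obtain ⟨a, ha⟩ := exists_colNorm_eq_entry i g j
  have hne : mat D g a j ≠ 0 := by
    intro h
    have := colNorm_pos (i := i) g j
    rw [ha, h, norm_zero, zero_mul] at this
    exact this.false
  obtain ⟨n, hn⟩ := exists_norm_eq_zpow D hne
  exact ⟨n + (i.weight a - i.weight j), by rw [ha, hn, ← zpow_add₀ norm_ϖ_pos.ne']⟩

theorem colNorm_mul_le {x : unitaryG D} {d : ℤ}
    (hx : ∀ a b, InPow D (d + i.weight b - i.weight a) (mat D x a b)) (g : unitaryG D)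
    (j : Fin 3) : colNorm i (x * g) j ≤ ‖D.ϖ‖ ^ d * colNorm i g j := by
  choose m hm using exists_colNorm_eq_zpow i g
  rw [hm, ← zpow_add₀ norm_ϖ_pos.ne', colNorm_le_zpow_iff]
  intro a
  rw [mat_mul]
  refine inPow_entry_mul (e₁ := fun a b => d + i.weight b - i.weight a)
    (e₂ := fun b j => m j + i.weight j - i.weight b) hx
    (fun b j => colNorm_le_zpow_iff.1 (hm j).le b) fun b => ?_
  ring_nf
  exact le_refl _

theorem colNorm_mul_le_of_mem {κ : unitaryG D} (hκ : κ ∈ maxK D i) (g : unitaryG D) (j : Fin 3) :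
    colNorm i (κ * g) j ≤ colNorm i g j := by
  have h := colNorm_mul_le (i := i) (d := 0) (fun a b => (hκ a b).mono (by
    cases i <;> fin_cases a <;> fin_cases b <;> decide)) g j
  rwa [zpow_zero, one_mul] at h

/-- The norms of the columns are invariant under left translation by `K`. -/
theorem colNorm_mul_left {κ : unitaryG D} (hκ : κ ∈ maxK D i) (g : unitaryG D) (j : Fin 3) :
    colNorm i (κ * g) j = colNorm i g j := by
  refine le_antisymm (colNorm_mul_le_of_mem hκ g j) ?_
  have h := colNorm_mul_le_of_mem ((maxK D i).inv_mem hκ) (κ * g) j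
  rwa [inv_mul_cancel_left] at h

theorem colNorm_alpha_zpow_mul_le {n : ℤ} (hn : n = 1 ∨ n = -1) (g : unitaryG D) (j : Fin 3) :
    colNorm i (alpha D ^ n * g) j ≤ ‖D.ϖ‖ ^ (-1 : ℤ) * colNorm i g j := by
  refine colNorm_mul_le (fun a b => ?_) g j
  rw [← mul_one (alpha D ^ n), mat_alpha_zpow_mul, mat_one, Matrix.one_apply]
  split_ifs with h
  · subst h
    refine (inPow_zpow_mul InPow.one).mono ?_
    rcases hn with rfl | rfl <;> fin_cases a <;> simp
  · rw [mul_zero]; exact InPow.zero _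

theorem weyl_mem : weyl D i ∈ maxK D i := by
  intro a b
  rw [← mul_one (weyl D i), mat_weyl_mul, mat_one, Matrix.one_apply]
  split_ifs with h
  · subst h
    refine (inPow_zpow_mul InPow.one).mono ?_
    cases i <;> fin_cases a <;> decide
  · rw [mul_zero]; exact InPow.zero _

theorem weyl_conj_mem {u : unitaryG D} (hu : u ∈ proIwahori D i) :
    weyl D i * u * weyl D i ∈ proIwahori' D i := by
  refine ⟨fun a b => ?_, fun a => ?_⟩
  · rw [mat_weyl_conj]
    refine (inPow_zpow_mul (hu.1 _ _)).mono ?_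
    cases i <;> fin_cases a <;> fin_cases b <;> decide
  · rw [mat_weyl_conj, sub_self, zero_mul, zpow_zero, one_mul]
    exact hu.2 _

theorem norm_diag_of_mem {b : unitaryG D} (hb : b ∈ iwahori D i) (a : Fin 3) :
    ‖mat D b a a‖ = 1 := by
  have hI := i.isIwahoriLevel
  have h := diag_mul_sub hb ((iwahori D i).inv_mem hb) (i := a)
    (fun j hj => hI.one_le a j hj.symm)
  rw [← mat_mul, mul_inv_cancel, mat_one, Matrix.one_apply_eq] at h
  have h1 := isUnit_of_sub_one (D := D) (by simpa using h.neg)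
  rw [norm_mul] at h1
  have h2 : ‖mat D b a a‖ ≤ 1 := by simpa [InPow, hI.diag] using hb a a
  have h3 : ‖mat D b⁻¹ a a‖ ≤ 1 := by
    simpa [InPow, hI.diag] using (iwahori D i).inv_mem hb a a
  nlinarith [norm_nonneg (mat D b a a)]

theorem colNorm_of_nonneg {n : ℤ} (hn : 0 ≤ n) {b : unitaryG D} (hb : b ∈ iwahori D i) :
    ‖D.ϖ‖ ^ (-n) ≤ colNorm i (alpha D ^ n * b) 0 ∧
      colNorm i (alpha D ^ n * b) 2 ≤ ‖D.ϖ‖ ^ (-n) := by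
  constructor
  · refine le_trans (le_of_eq ?_) (le_colNorm _ 0 0)
    rw [mat_alpha_zpow_mul, norm_mul, norm_zpow_ϖ, norm_diag_of_mem hb]
    simp
  · rw [colNorm_le_zpow_iff]
    intro a
    rw [mat_alpha_zpow_mul]
    refine (inPow_zpow_mul (hb _ _)).mono ?_
    cases i <;> fin_cases a <;> simp [MaxCpt.weight, MaxCpt.corner, MaxCpt.iwLevel] <;> omega

theorem colNorm_of_neg {n : ℤ} (hn : n < 0) {b : unitaryG D} (hb : b ∈ iwahori D i) :
    ‖D.ϖ‖ ^ n ≤ colNorm i (alpha D ^ n * b) 2 ∧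
      colNorm i (alpha D ^ n * b) 0 ≤ ‖D.ϖ‖ ^ (n + 1) := by
  constructor
  · refine le_trans (le_of_eq ?_) (le_colNorm _ 2 2)
    rw [mat_alpha_zpow_mul, norm_mul, norm_zpow_ϖ, norm_diag_of_mem hb]
    simp
  · rw [colNorm_le_zpow_iff]
    intro a
    rw [mat_alpha_zpow_mul]
    refine (inPow_zpow_mul (hb _ _)).mono ?_
    cases i <;> fin_cases a <;> simp [MaxCpt.weight, MaxCpt.corner, MaxCpt.iwLevel] <;> omega

end ColumnNorm

/-! ### The decomposition of `G` into the double cosets `K αⁿ I_K` -/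

section Decomposition

variable {F E : Type*} [NontriviallyNormedField F] [IsUltrametricDist F] [ProperSpace F]
  [NormedField E] [NormedAlgebra F E] {D : UnramifiedQuadratic F E} {i : MaxCpt}

/-- The middle entry of an isotropic vector is bounded by the geometric mean of the outer ones. -/
theorem norm_sq_le_of_isotropic {a b c : E}
    (h : a * D.conj c + b * D.conj b + c * D.conj a = 0) : ‖b‖ ^ 2 ≤ ‖a‖ * ‖c‖ := by
  have : IsUltrametricDist E := IsUltrametricDist.of_normedAlgebra F
  have h1 : b * D.conj b = -(a * D.conj c + c * D.conj a) := by linear_combination h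
  have h2 : ‖b‖ ^ 2 = ‖a * D.conj c + c * D.conj a‖ := by
    rw [← norm_neg (_ + _), ← h1, norm_mul, norm_conj, sq]
  rw [h2]
  refine (IsUltrametricDist.norm_add_le_max _ _).trans (max_le ?_ ?_)
  · rw [norm_mul, norm_conj]
  · rw [norm_mul, norm_conj, mul_comm]

/-- The first column of `g` is isotropic, so it attains its norm in the first or last row; the
Weyl element moves the last row to the first. -/
theorem exists_pivot (i : MaxCpt) (g : unitaryG D) :
    ∃ κ ∈ maxK D i, colNorm i (κ * g) 0 ≤ ‖mat D (κ * g) 0 0‖ := by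
  obtain ⟨a, ha⟩ := exists_colNorm_eq_entry i g 0
  have hw0 : i.weight 0 = 0 := rfl
  have hw1 : i.weight 1 = 0 := rfl
  have hw2 : i.weight 2 = -i.corner := rfl
  have hr := norm_ϖ_pos (D := D)
  fin_cases a
  · refine ⟨1, (maxK D i).one_mem, ?_⟩
    rw [one_mul, ha]
    simp
  · refine ⟨1, (maxK D i).one_mem, ?_⟩
    have h0 := le_colNorm (i := i) g 0 0
    have h2 := le_colNorm (i := i) g 2 0
    have hpos := colNorm_pos (i := i) g 0
    have hrel := unitaryG_rel D g 0 0
    simp only [Fin.reduceRev, Fin.reduceEq, if_false] at hrel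
    have hsq := norm_sq_le_of_isotropic hrel
    simp only [hw0, hw1, hw2, sub_zero, zpow_zero, mul_one, Fin.mk_one] at ha h0 h2
    have h3 : 1 ≤ ‖D.ϖ‖ ^ (-i.corner) := by
      rw [← zpow_zero ‖D.ϖ‖, zpow_norm_ϖ_le_iff]
      cases i <;> decide
    have h4 : ‖mat D g 2 0‖ ≤ colNorm i g 0 := by
      nlinarith [norm_nonneg (mat D g 2 0)]
    rw [← ha, sq] at hsq
    rw [one_mul]
    refine le_of_mul_le_mul_right (hsq.trans ?_) hpos
    gcongr
  · refine ⟨weyl D i, weyl_mem, ?_⟩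
    rw [colNorm_mul_left weyl_mem, ha, mat_weyl_mul, norm_mul, norm_zpow_ϖ, mul_comm, hw0]
    simp [hw2, Fin.rev]

/-- Elimination: if the first column of `g` dominates the last one, then `g ∈ K αⁿ b` with `b`
upper triangular. The parameter `ε` measures by how much the column dominates, and improves the
bounds for `b` accordingly. -/
theorem exists_eq_mul_upper {g : unitaryG D} {ε : ℤ}
    (h : colNorm i g 2 ≤ ‖D.ϖ‖ ^ ε * colNorm i g 0) :
    ∃ κ ∈ maxK D i, ∃ (n : ℤ) (b : unitaryG D), g = κ * alpha D ^ n * b ∧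
      (∀ a, ‖mat D b a a‖ = 1) ∧ (∀ a c, c < a → mat D b a c = 0) ∧
      InPow D (ε - i.corner) (mat D b 0 2) ∧
      ∀ m : ℤ, 2 * m - 1 ≤ ε - i.corner →
        InPow D m (mat D b 0 1) ∧ InPow D m (mat D b 1 2) := by
  have hr := norm_ϖ_pos (D := D)
  have hw0 : i.weight 0 = 0 := rfl
  have hw2 : i.weight 2 = -i.corner := rfl
  obtain ⟨κ₀, hκ₀, hp⟩ := exists_pivot i g
  rw [← colNorm_mul_left hκ₀, ← colNorm_mul_left hκ₀ g 0] at h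
  obtain ⟨g', hg'⟩ : ∃ g', g' = κ₀ * g := ⟨_, rfl⟩
  rw [← hg'] at h hp
  have hpos : 0 < ‖mat D g' 0 0‖ := (colNorm_pos (i := i) g' 0).trans_le hp
  have h00 : mat D g' 0 0 ≠ 0 := norm_pos_iff.1 hpos
  -- The lower unipotent element of `K` that clears the first column.
  let u : E := mat D g' 1 0 / mat D g' 0 0
  let w : E := mat D g' 2 0 / mat D g' 0 0
  have hrel := unitaryG_rel D g' 0 0
  simp only [Fin.reduceRev, Fin.reduceEq, if_false] at hrel
  have h00c : D.conj (mat D g' 0 0) ≠ 0 := by simpa using h00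
  have huw : u * D.conj u + w + D.conj w = 0 := by
    simp only [u, w, map_div₀]
    field_simp
    linear_combination hrel
  let n := lowerUnip D u w huw (conj_conj D u)
  have hnm : mat D n = !![1, 0, 0; u, 1, 0; w, -D.conj u, 1] := rfl
  have hw : InPow D i.corner w := by
    have h1 := (le_colNorm (i := i) g' 2 0).trans hp
    rw [hw0, hw2, sub_zero, zpow_neg, ← div_eq_mul_inv, div_le_iff₀ (by positivity)] at h1
    unfold InPow
    rw [norm_div, div_le_iff₀ hpos, mul_comm]
    exact h1
  have hu2 : ‖u‖ ^ 2 ≤ ‖D.ϖ‖ ^ i.corner := by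
    have h1 := norm_sq_le_of_isotropic (D := D) (a := 1) (b := u) (c := w) (by
      rw [map_one]; linear_combination huw)
    rw [norm_one, one_mul] at h1
    exact h1.trans hw
  have hu : InPow D i.corner u := inPow_of_norm_sq_le hu2 (by cases i <;> decide)
  have hnK : n ∈ maxK D i := by
    intro a b
    rw [hnm]
    fin_cases a <;> fin_cases b <;>
      first
      | exact InPow.zero _
      | exact InPow.one.mono (by cases i <;> decide)
      | exact hu.mono (by cases i <;> decide)
      | exact hw.mono (by cases i <;> decide)
      | exact hu.conj.neg.mono (by cases i <;> decide)
  obtain ⟨x, hx⟩ : ∃ x, x = n⁻¹ * g' := ⟨_, rfl⟩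
  have hxn : g' = n * x := by rw [hx]; group
  have hent : ∀ a c, mat D g' a c = mat D n a 0 * mat D x 0 c + mat D n a 1 * mat D x 1 c +
      mat D n a 2 * mat D x 2 c := by
    intro a c; rw [hxn, mat_mul, Matrix.mul_apply, Fin.sum_univ_three]
  have hx0 : ∀ c, mat D x 0 c = mat D g' 0 c := by
    intro c
    have := hent 0 c; simp [hnm] at this; exact this.symm
  have hx10 : mat D x 1 0 = 0 := by
    have := hent 1 0
    simp only [hnm, hx0, u] at this
    simp [h00] at this; exact this
  have hx20 : mat D x 2 0 = 0 := by
    have := hent 2 0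
    simp only [hnm, hx0, hx10, w] at this
    simp [h00] at this; exact this
  obtain ⟨l, hl⟩ := exists_norm_eq_zpow D h00
  obtain ⟨b, hb⟩ : ∃ b, b = alpha D ^ l * x := ⟨_, rfl⟩
  have hbe : ∀ a c, mat D b a c = algebraMap F E D.ϖ ^ (l * ((a : ℤ) - 1)) * mat D x a c := by
    intro a c; rw [hb, mat_alpha_zpow_mul]
  have hb00 : ‖mat D b 0 0‖ = 1 := by
    rw [hbe, norm_mul, norm_zpow_ϖ, hx0, hl, ← zpow_add₀ hr.ne']
    simp
  have hb00' : mat D b 0 0 ≠ 0 := by rw [← norm_pos_iff, hb00]; exact one_pos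
  have hb10 : mat D b 1 0 = 0 := by rw [hbe, hx10, mul_zero]
  have hb20 : mat D b 2 0 = 0 := by rw [hbe, hx20, mul_zero]
  have hb21 : mat D b 2 1 = 0 := by
    have := unitaryG_rel D b 0 1
    simpa [Fin.rev, hb10, hb20, hb00'] using this
  have hb22 : ‖mat D b 2 2‖ = 1 := by
    have h1 := unitaryG_rel D b 0 2
    simp [Fin.rev, hb10, hb20] at h1
    have h2 := congrArg norm h1
    rwa [norm_mul, norm_conj, hb00, one_mul, norm_one] at h2
  have hb11 : ‖mat D b 1 1‖ = 1 := by
    have h1 := unitaryG_rel D b 1 1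
    simp [Fin.rev, hb21] at h1
    have h2 := congrArg norm h1
    rw [norm_mul, norm_conj, norm_one] at h2
    nlinarith [norm_nonneg (mat D b 1 1)]
  have hb02 : InPow D (ε - i.corner) (mat D b 0 2) := by
    have h1 := (le_colNorm (i := i) g' 0 2).trans (h.trans
      (mul_le_mul_of_nonneg_left hp (by positivity)))
    rw [hw0, hw2, sub_neg_eq_add, zero_add, hl, ← zpow_add₀ hr.ne',
      ← le_div_iff₀ (by positivity), ← zpow_sub₀ hr.ne'] at h1
    have h2 := inPow_zpow_mul (m := l * (((0 : Fin 3) : ℕ) - 1)) h1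
    rw [hbe, hx0]
    refine h2.mono (le_of_eq ?_)
    simp; ring
  refine ⟨κ₀⁻¹ * n, (maxK D i).mul_mem ((maxK D i).inv_mem hκ₀) hnK, -l, b, ?_, ?_, ?_, hb02,
    fun m hm => ⟨?_, ?_⟩⟩
  · rw [hb, mul_assoc, mul_assoc, ← mul_assoc (alpha D ^ (-l)), ← zpow_add, neg_add_cancel,
      zpow_zero, one_mul, ← hxn, hg', inv_mul_cancel_left]
  · intro a
    fin_cases a
    exacts [hb00, hb11, hb22]
  · intro a c hac
    fin_cases a <;> fin_cases c <;>
      first | exact absurd hac (by decide) | exact hb10 | exact hb20 | exact hb21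
  · refine inPow_of_norm_sq_le (le_trans ?_ hb02) hm
    -- The row relations of `b` are the column relations of its inverse.
    have h1 := unitaryG_rel D b⁻¹ 2 2
    simp only [mat_inv, conj_conj, Fin.reduceRev, Fin.reduceEq, if_false] at h1
    have h2 := norm_sq_le_of_isotropic (D := D) (a := mat D b 0 0) (b := mat D b 0 1)
      (c := mat D b 0 2) (by linear_combination h1)
    rwa [hb00, one_mul] at h2
  · refine inPow_of_norm_sq_le (le_trans ?_ hb02) hm
    have h1 := unitaryG_rel D b 2 2
    simp only [Fin.reduceRev, Fin.reduceEq, if_false] at h1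
    have h2 := norm_sq_le_of_isotropic h1
    rwa [hb22, mul_one] at h2

/-- `G` is the union of the double cosets `K αⁿ I_K`. -/
theorem exists_mem_doubleCoset (i : MaxCpt) (g : unitaryG D) :
    ∃ n : ℤ, g ∈ doubleCoset i (alpha D ^ n) := by
  rcases le_or_gt (colNorm i g 2) (colNorm i g 0) with h | h
  · obtain ⟨κ, hκ, n, b, hg, hd, hlow, h02, hm⟩ :=
      exists_eq_mul_upper (i := i) (g := g) (ε := 0) (by rwa [zpow_zero, one_mul])
    obtain ⟨h01, h12⟩ := hm 0 (by cases i <;> decide)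
    refine ⟨n, κ, hκ, b, fun a c => ?_, hg⟩
    rcases lt_trichotomy c a with hac | rfl | hac
    · rw [hlow a c hac]; exact InPow.zero _
    · exact InPow.mono (n := i.iwLevel c c) (m := 0) (by simp [InPow, hd])
        (i.isIwahoriLevel.diag c).le
    · fin_cases a <;> fin_cases c <;>
        first
        | exact absurd hac (by decide)
        | exact h01.mono (by cases i <;> decide)
        | exact h12.mono (by cases i <;> decide)
        | exact h02.mono (by cases i <;> decide)
  · -- Swapping the outer columns of `g` turns the strict inequality into domination with `ε = 1`.
    have hcol : ∀ j, colNorm i (g * weyl D i) j = colNorm i g j.rev := by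
      intro j
      unfold colNorm
      congr 1
      ext a
      rw [mat_mul_weyl, norm_mul, norm_zpow_ϖ, mul_comm (_ ^ _), mul_assoc,
        ← zpow_add₀ norm_ϖ_pos.ne']
      congr 2
      fin_cases j <;> simp [MaxCpt.weight, Fin.rev, add_comm]
    obtain ⟨m₀, hm₀⟩ := exists_colNorm_eq_zpow i g 0
    obtain ⟨m₂, hm₂⟩ := exists_colNorm_eq_zpow i g 2
    obtain ⟨κ, hκ, n, b, hg, hd, hlow, h02, hm⟩ :=
      exists_eq_mul_upper (i := i) (g := g * weyl D i) (ε := 1) (by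
        rw [hcol, hcol]
        change colNorm i g 0 ≤ _ * colNorm i g 2
        rw [hm₀, hm₂, zpow_norm_ϖ_lt_iff] at h
        rw [hm₀, hm₂, ← zpow_add₀ norm_ϖ_pos.ne', zpow_norm_ϖ_le_iff]
        omega)
    obtain ⟨h01, h12⟩ := hm (1 - i.corner) (by cases i <;> decide)
    refine ⟨-n, κ * weyl D i, (maxK D i).mul_mem hκ weyl_mem, weyl D i * b * weyl D i,
      fun a c => ?_, ?_⟩
    · rw [mat_weyl_conj]
      rcases lt_trichotomy a c with hac | rfl | hac
      · rw [hlow _ _ (Fin.rev_lt_rev.2 hac), mul_zero]; exact InPow.zero _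
      · refine (inPow_zpow_mul (n := 0) (by simp [InPow, hd])).mono ?_
        rw [i.isIwahoriLevel.diag]; simp
      · fin_cases a <;> fin_cases c <;>
          first
          | exact absurd hac (by decide)
          | exact (inPow_zpow_mul h01).mono (by cases i <;> decide)
          | exact (inPow_zpow_mul h12).mono (by cases i <;> decide)
          | exact (inPow_zpow_mul h02).mono (by cases i <;> decide)
    · calc g = g * weyl D i * weyl D i := by rw [mul_assoc, weyl_mul_weyl, mul_one]
        _ = κ * (alpha D ^ n * (weyl D i * weyl D i)) * b * weyl D i := by
          rw [hg, weyl_mul_weyl, mul_one]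
        _ = κ * weyl D i * alpha D ^ (-n) * (weyl D i * b * weyl D i) := by
          rw [← mul_assoc (alpha D ^ n), ← neg_neg n, ← weyl_mul_alpha_zpow, neg_neg]
          simp only [mul_assoc]

theorem colNorm_of_mem_nonneg {g : unitaryG D} {n : ℤ} (hg : g ∈ doubleCoset i (alpha D ^ n))
    (hn : 0 ≤ n) : ‖D.ϖ‖ ^ (-n) ≤ colNorm i g 0 ∧ colNorm i g 2 ≤ colNorm i g 0 := by
  obtain ⟨κ, hκ, b, hb, rfl⟩ := hg
  rw [mul_assoc, colNorm_mul_left hκ, colNorm_mul_left hκ]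
  obtain ⟨h1, h2⟩ := colNorm_of_nonneg hn hb
  exact ⟨h1, h2.trans h1⟩

theorem colNorm_of_mem_neg {g : unitaryG D} {n : ℤ} (hg : g ∈ doubleCoset i (alpha D ^ n))
    (hn : n < 0) : ‖D.ϖ‖ ^ n ≤ colNorm i g 2 ∧ colNorm i g 0 < colNorm i g 2 := by
  obtain ⟨κ, hκ, b, hb, rfl⟩ := hg
  rw [mul_assoc, colNorm_mul_left hκ, colNorm_mul_left hκ]
  obtain ⟨h1, h2⟩ := colNorm_of_neg hn hb
  exact ⟨h1, h2.trans_lt (lt_of_lt_of_le (zpow_norm_ϖ_lt_iff.2 (by omega)) h1)⟩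

/-- The elements of `G` whose vertex lies on the same side as `K` of the edge fixed by `I_K`: the
union of the double cosets `K αⁿ I_K` for `n ≥ 0` (see `mem_plusSide_iff`), encoded by a comparison
of column norms. -/
def plusSide (D : UnramifiedQuadratic F E) (i : MaxCpt) : Set (unitaryG D) :=
  {g | colNorm i g 2 ≤ colNorm i g 0}

theorem mem_plusSide_iff {g : unitaryG D} {n : ℤ} (hg : g ∈ doubleCoset i (alpha D ^ n)) :
    g ∈ plusSide D i ↔ 0 ≤ n := by
  refine ⟨fun h => ?_, fun hn => (colNorm_of_mem_nonneg hg hn).2⟩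
  by_contra! hn
  exact (colNorm_of_mem_neg hg hn).2.not_ge h

theorem mul_mem_doubleCoset_iff {κ g b x : unitaryG D} (hκ : κ ∈ maxK D i)
    (hb : b ∈ iwahori D i) : κ * g * b ∈ doubleCoset i x ↔ g ∈ doubleCoset i x := by
  constructor
  · rintro ⟨κ', hκ', b', hb', h⟩
    refine ⟨κ⁻¹ * κ', mul_mem (inv_mem hκ) hκ', b' * b⁻¹, mul_mem hb' (inv_mem hb), ?_⟩
    calc g = κ⁻¹ * (κ * g * b) * b⁻¹ := by group
      _ = _ := by rw [h]; group
  · rintro ⟨κ', hκ', b', hb', rfl⟩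
    exact ⟨κ * κ', mul_mem hκ hκ', b' * b, mul_mem hb' hb, by group⟩

theorem mul_mem_plusSide_iff {κ g b : unitaryG D} (hκ : κ ∈ maxK D i) (hb : b ∈ iwahori D i) :
    κ * g * b ∈ plusSide D i ↔ g ∈ plusSide D i := by
  obtain ⟨n, hn⟩ := exists_mem_doubleCoset i g
  rw [mem_plusSide_iff hn, mem_plusSide_iff ((mul_mem_doubleCoset_iff hκ hb).2 hn)]

theorem mem_doubleCoset_zero_iff {g : unitaryG D} :
    g ∈ doubleCoset i (alpha D ^ (0 : ℤ)) ↔ g ∈ maxK D i := by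
  rw [zpow_zero]
  constructor
  · rintro ⟨κ, hκ, b, hb, rfl⟩
    exact mul_mem (mul_mem hκ (one_mem _)) (iwahori_le D i hb)
  · intro hg
    exact ⟨g, hg, 1, one_mem _, by simp⟩

/-- The double coset `K α K`. -/
def heckeSupport (D : UnramifiedQuadratic F E) (i : MaxCpt) : Set (unitaryG D) :=
  {y | ∃ κ ∈ maxK D i, ∃ κ' ∈ maxK D i, y = κ * alpha D * κ'}

theorem colNorm_heckeSupport {y : unitaryG D} (hy : y ∈ heckeSupport D i) (g : unitaryG D)
    (j : Fin 3) :
    colNorm i (y * g) j ≤ ‖D.ϖ‖ ^ (-1 : ℤ) * colNorm i g j ∧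
      ‖D.ϖ‖ * colNorm i g j ≤ colNorm i (y * g) j := by
  obtain ⟨κ, hκ, κ', hκ', rfl⟩ := hy
  have h1 := colNorm_alpha_zpow_mul_le (i := i) (.inl rfl) (κ' * g) j
  have h2 := colNorm_alpha_zpow_mul_le (i := i) (.inr rfl) (alpha D * (κ' * g)) j
  rw [zpow_one, colNorm_mul_left hκ'] at h1
  rw [← mul_assoc, zpow_neg, zpow_one, inv_mul_cancel, one_mul, colNorm_mul_left hκ', zpow_neg,
    zpow_one] at h2
  rw [mul_assoc, mul_assoc, colNorm_mul_left hκ]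
  refine ⟨h1, ?_⟩
  rwa [← le_inv_mul_iff₀ norm_ϖ_pos]

/-- Translation by `K α K` changes the index of a double coset `K αⁿ I_K` across `0` only between
`0` and `-1`. -/
theorem index_of_heckeSupport_mul {y h : unitaryG D} {n l : ℤ} (hy : y ∈ heckeSupport D i)
    (hh : h ∈ doubleCoset i (alpha D ^ n)) (hyh : y * h ∈ doubleCoset i (alpha D ^ l)) :
    (0 ≤ n → l < 0 → n = 0 ∧ l = -1) ∧ (n < 0 → 0 ≤ l → n = -1 ∧ l = 0) := by
  obtain ⟨κ, hκ, b, hb, rfl⟩ := hh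
  have hy' : y * κ ∈ heckeSupport D i := by
    obtain ⟨κ₁, hκ₁, κ₂, hκ₂, rfl⟩ := hy
    exact ⟨κ₁, hκ₁, κ₂ * κ, mul_mem hκ₂ hκ, by group⟩
  rw [show y * (κ * alpha D ^ n * b) = 1 * (y * κ * alpha D ^ n) * b by group,
    mul_mem_doubleCoset_iff (one_mem _) hb] at hyh
  have hr := norm_ϖ_pos (D := D)
  have hα : ∀ j, colNorm i (alpha D ^ n) j = ‖D.ϖ‖ ^ (n * ((j : ℤ) - 1)) := by
    intro j
    have hm : ∀ a, mat D (alpha D ^ n) a j =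
        algebraMap F E D.ϖ ^ (n * ((a : ℤ) - 1)) * if a = j then 1 else 0 := by
      intro a
      rw [← mul_one (alpha D ^ n), mat_alpha_zpow_mul, mat_one, Matrix.one_apply]
    refine le_antisymm (colNorm_le_zpow_iff.2 fun a => ?_) ?_
    · rw [hm]
      split_ifs with h
      · subst h
        exact (inPow_zpow_mul InPow.one).mono (by omega)
      · rw [mul_zero]; exact InPow.zero _
    · refine le_trans (le_of_eq ?_) (le_colNorm _ j j)
      rw [hm, if_pos rfl, mul_one, norm_zpow_ϖ, sub_self, zpow_zero, mul_one]
  obtain ⟨h0u, h0l⟩ := colNorm_heckeSupport hy' (alpha D ^ n) 0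
  obtain ⟨h2u, h2l⟩ := colNorm_heckeSupport hy' (alpha D ^ n) 2
  rw [hα, ← zpow_add₀ hr.ne'] at h0u h2u
  rw [hα, ← zpow_one_add₀ hr.ne'] at h0l h2l
  constructor
  · intro hn hl
    obtain ⟨h1, h2⟩ := colNorm_of_mem_neg hyh hl
    have h3 := zpow_norm_ϖ_lt_iff.1 ((h0l.trans_lt h2).trans_le h2u)
    have h4 := zpow_norm_ϖ_le_iff.1 (h1.trans h2u)
    simp at h3 h4
    omega
  · intro hn hl
    obtain ⟨h1, h2⟩ := colNorm_of_mem_nonneg hyh hl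
    have h3 := zpow_norm_ϖ_le_iff.1 ((h2l.trans h2).trans h0u)
    have h4 := zpow_norm_ϖ_le_iff.1 (h1.trans h0u)
    simp at h3 h4
    omega

end Decomposition

/-! ### The Hecke operator across the edge fixed by `I_K` -/

section Operator

variable {F E : Type*} [NontriviallyNormedField F] [IsUltrametricDist F] [ProperSpace F]
  [NormedField E] [NormedAlgebra F E] {D : UnramifiedQuadratic F E} {i : MaxCpt}
  {k W : Type*} [Field k] [AddCommGroup W] [Module k W] {σ : Representation k (maxK D i) W}

theorem jMap_mem_invariants (w : W) : jMap σ w ∈ (resPro σ).invariants := by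
  unfold jMap
  split_ifs
  · exact Subtype.mem _
  · exact zero_mem _

theorem jMap_apply_of_mem {u : maxK D i} (hu : (u : unitaryG D) ∈ proIwahori' D i) (w : W) :
    jMap σ (σ u w) = jMap σ w := by
  unfold jMap
  split_ifs
  · have h : Representation.Coinvariants.mk (resPro' σ) (σ u w) =
        Representation.Coinvariants.mk (resPro' σ) w :=
      (Representation.Coinvariants.mk_eq_iff (ρ := resPro' σ)).2 (sub_mem_ker' σ hu w)
    simp only [LinearMap.comp_apply, h]
  · rfl

theorem mem_heckeSupport {y : unitaryG D} (h : heckeFun σ y ≠ 0) : y ∈ heckeSupport D i := by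
  unfold heckeFun at h
  split_ifs at h with hq
  · obtain ⟨q, hq⟩ := hq
    exact ⟨q.1, q.1.2, q.2, q.2.2, hq⟩
  · exact absurd rfl h

theorem heckeT_apply (f : indSpace σ) (g : unitaryG D) :
    (heckeT σ f).1 g = ∑ᶠ y : unitaryG D ⧸ maxK D i, heckeFun σ y.out (f.1 (y.out⁻¹ * g)) := rfl

theorem exists_of_heckeT_ne_zero {f : indSpace σ} {g : unitaryG D} (h : (heckeT σ f).1 g ≠ 0) :
    ∃ y ∈ heckeSupport D i, f.1 (y⁻¹ * g) ≠ 0 := by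
  obtain ⟨y, hy⟩ : ∃ y : unitaryG D ⧸ maxK D i,
      heckeFun σ y.out (f.1 (y.out⁻¹ * g)) ≠ 0 := by
    by_contra! h0
    exact h (by rw [heckeT_apply, finsum_eq_zero_of_forall_eq_zero h0])
  refine ⟨y.out, mem_heckeSupport (σ := σ) fun h0 => hy ?_, fun h0 => hy ?_⟩
  · rw [h0]; rfl
  · rw [h0, map_zero]

theorem heckeT_eq_zero {f : indSpace σ} {n l : ℤ}
    (hf : f ∈ supportedIn σ (doubleCoset i (alpha D ^ n))) {g : unitaryG D}
    (hg : g ∈ doubleCoset i (alpha D ^ l))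
    (h : ¬((0 ≤ n → l < 0 → n = 0 ∧ l = -1) ∧ (n < 0 → 0 ≤ l → n = -1 ∧ l = 0))) :
    (heckeT σ f).1 g = 0 := by
  by_contra hne
  obtain ⟨y, hy, hfy⟩ := exists_of_heckeT_ne_zero hne
  exact h (index_of_heckeSupport_mul hy (hf _ hfy) (by rwa [mul_inv_cancel_left]))

/-- A formula for `φ` on `K α⁻¹ I_K`, where `α⁻¹ = s α s` with the Weyl element `s`. -/
theorem heckeFun_alpha_inv (κ b : maxK D i) :
    heckeFun σ (κ * alpha D ^ (-1 : ℤ) * b) =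
      σ (κ * ⟨weyl D i, weyl_mem⟩) * jMap σ * σ (⟨weyl D i, weyl_mem⟩ * b) := by
  rw [← heckeFun_apply]
  congr 1
  have h := weyl_mul_alpha_zpow (D := D) (i := i) 1
  rw [zpow_one] at h
  calc (κ * alpha D ^ (-1 : ℤ) * b : unitaryG D)
      = κ * (alpha D ^ (-1 : ℤ) * weyl D i) * (weyl D i * b) := by
        simp only [mul_assoc]
        rw [← mul_assoc (weyl D i) (weyl D i), weyl_mul_weyl, one_mul]
    _ = κ * weyl D i * alpha D * (weyl D i * b) := by rw [← h]; simp only [mul_assoc]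

/-- On `K α⁻¹ I_K` the function `φ` is invariant under right translation by `I_{1,K}`, because the
Weyl element conjugates `I_{1,K}` into `I'_{1,K}`, which acts trivially on the source of `j_σ`. -/
theorem heckeFun_mul_right {g u : unitaryG D} (hg : g ∈ doubleCoset i (alpha D ^ (-1 : ℤ)))
    (hu : u ∈ proIwahori D i) : heckeFun σ (g * u) = heckeFun σ g := by
  obtain ⟨κ, hκ, b, hb, rfl⟩ := hg
  have hu' : b * u * b⁻¹ ∈ proIwahori D i := levelGroup₁_conj hb hu
  have hbK := iwahori_le D i hb
  have huK := proIwahori_le D i hu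
  have h1 := heckeFun_alpha_inv (σ := σ) ⟨κ, hκ⟩ ⟨b, hbK⟩
  have h2 := heckeFun_alpha_inv (σ := σ) ⟨κ, hκ⟩ ⟨b * u, mul_mem hbK huK⟩
  simp only at h1 h2
  rw [mul_assoc, h1, h2, mul_assoc, mul_assoc]
  congr 1
  ext w
  have h3 : (⟨weyl D i, weyl_mem⟩ * ⟨b * u, mul_mem hbK huK⟩ : maxK D i) =
      ⟨_, proIwahori'_le D i (weyl_conj_mem hu')⟩ * (⟨weyl D i, weyl_mem⟩ * ⟨b, hbK⟩) := by
    ext1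
    change weyl D i * (b * u) = weyl D i * (b * u * b⁻¹) * weyl D i * (weyl D i * b)
    rw [mul_assoc _ (weyl D i) (weyl D i * b), ← mul_assoc (weyl D i) (weyl D i) b, weyl_mul_weyl]
    group
  rw [h3, map_mul, Module.End.mul_apply, Module.End.mul_apply, Module.End.mul_apply]
  exact jMap_apply_of_mem (weyl_conj_mem hu') _

theorem heckeT_apply_of_supportedIn_maxK {f : indSpace σ}
    (hf : f ∈ supportedIn σ (doubleCoset i (alpha D ^ (0 : ℤ)))) (g : unitaryG D) :
    (heckeT σ f).1 g = heckeFun σ g (f.1 1) := by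
  rw [heckeT_apply, finsum_eq_single _ (g : unitaryG D ⧸ maxK D i)]
  · rw [conv_term (heckeFun_biequivariant σ), inv_mul_cancel]
  · intro y hy
    have : f.1 (y.out⁻¹ * g) = 0 := by
      by_contra hne
      apply hy
      rw [← y.out_eq]
      exact QuotientGroup.eq.2 (mem_doubleCoset_zero_iff.1 (hf _ hne))
    rw [this, map_zero]

theorem heckeT_one_mem_invariants {f : indSpace σ}
    (hf : f ∈ supportedIn σ (doubleCoset i (alpha D ^ (-1 : ℤ)))) :
    (heckeT σ f).1 1 ∈ (resPro σ).invariants := by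
  rw [heckeT_apply]
  refine finsum_induction (· ∈ (resPro σ).invariants) (zero_mem _) (fun _ _ => add_mem) fun y => ?_
  by_cases hne : f.1 (y.out⁻¹ * 1) = 0
  · rw [hne, map_zero]; exact zero_mem _
  obtain ⟨κ, hκ, b, hb, hy⟩ := hf _ hne
  have hbK := (maxK D i).inv_mem (iwahori_le D i hb)
  have hy' : y.out = b⁻¹ * alpha D * κ⁻¹ := by
    rw [← inv_inv y.out, ← mul_one (y.out⁻¹), hy]; group
  rw [hy']
  have h1 := heckeFun_apply σ ⟨b⁻¹, hbK⟩ ⟨κ⁻¹, inv_mem hκ⟩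
  simp only at h1
  rw [h1, Module.End.mul_apply, Module.End.mul_apply]
  -- `I_K` preserves the `I_{1,K}`-invariants, since it normalizes `I_{1,K}`.
  have hv := jMap_mem_invariants (σ := σ)
    (σ ⟨κ⁻¹, inv_mem hκ⟩ (f.1 ((b⁻¹ * alpha D * κ⁻¹)⁻¹ * 1)))
  generalize jMap σ (σ ⟨κ⁻¹, inv_mem hκ⟩ (f.1 ((b⁻¹ * alpha D * κ⁻¹)⁻¹ * 1))) = v at hv ⊢
  intro u
  have hu : b * (u.1 : unitaryG D) * b⁻¹ ∈ proIwahori D i :=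
    levelGroup₁_conj hb (Subgroup.mem_subgroupOf.1 u.2)
  have h2 := hv ⟨⟨_, proIwahori_le D i hu⟩, Subgroup.mem_subgroupOf.2 hu⟩
  change σ ⟨_, proIwahori_le D i hu⟩ v = v at h2
  change σ u.1 (σ ⟨b⁻¹, hbK⟩ v) = σ ⟨b⁻¹, hbK⟩ v
  conv_rhs => rw [← h2]
  rw [← Module.End.mul_apply, ← Module.End.mul_apply, ← map_mul, ← map_mul]
  congr 2
  ext1
  simp [mul_assoc]

/-- The image under `T` of a function on one side of the edge fixed by `I_K` is
`I_{1,K}`-invariant on the other side. -/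
theorem heckeT_mul_right {f : indSpace σ} {n l : ℤ}
    (hf : f ∈ supportedIn σ (doubleCoset i (alpha D ^ n))) {g u : unitaryG D}
    (hg : g ∈ doubleCoset i (alpha D ^ l)) (hnl : ¬(0 ≤ n ↔ 0 ≤ l)) (hu : u ∈ proIwahori D i) :
    (heckeT σ f).1 (g * u) = (heckeT σ f).1 g := by
  have hgu : g * u ∈ doubleCoset i (alpha D ^ l) := by
    rwa [← one_mul g, mul_mem_doubleCoset_iff (one_mem _) hu.1]
  by_cases h : (0 ≤ n → l < 0 → n = 0 ∧ l = -1) ∧ (n < 0 → 0 ≤ l → n = -1 ∧ l = 0)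
  swap
  · rw [heckeT_eq_zero hf hg h, heckeT_eq_zero hf hgu h]
  rcases le_or_gt 0 n with hn | hn
  · obtain ⟨rfl, rfl⟩ := h.1 hn (by omega)
    rw [heckeT_apply_of_supportedIn_maxK hf, heckeT_apply_of_supportedIn_maxK hf,
      heckeFun_mul_right hg hu]
  · obtain ⟨rfl, rfl⟩ := h.2 hn (by omega)
    have hgK := mem_doubleCoset_zero_iff.1 hg
    have huK := proIwahori_le D i hu
    have h1 := (heckeT σ f).2.1 ⟨g * u, mul_mem hgK huK⟩ 1
    have h2 := (heckeT σ f).2.1 ⟨g, hgK⟩ 1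
    have h3 := heckeT_one_mem_invariants hf ⟨⟨u, huK⟩, Subgroup.mem_subgroupOf.2 hu⟩
    change σ ⟨u, huK⟩ _ = _ at h3
    simp only [mul_one] at h1 h2
    rw [h1, h2]
    conv_rhs => rw [← h3]
    rw [← Module.End.mul_apply, ← map_mul]
    rfl

end Operator

/-! ### The two halves of `ind_K^G σ` -/

section Halves

variable {F E : Type*} [NontriviallyNormedField F] [IsUltrametricDist F] [ProperSpace F]
  [NormedField E] [NormedAlgebra F E] {D : UnramifiedQuadratic F E} {i : MaxCpt}
  {k W : Type*} [Field k] [AddCommGroup W] [Module k W] {σ : Representation k (maxK D i) W}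

theorem isLocallyConstant_of_left_invariant {X : Type*} {f : unitaryG D → X}
    (hf : ∀ κ ∈ maxK D i, ∀ g, f (κ * g) = f g) : IsLocallyConstant f := by
  rw [IsLocallyConstant.iff_exists_open]
  intro g
  refine ⟨(fun x => x * g⁻¹) ⁻¹' (maxK D i : Set (unitaryG D)),
    (isOpen_maxK D i).preimage (continuous_mul_const _), ?_, fun x hx => ?_⟩
  · simp [one_mem]
  · rw [← hf _ hx g, inv_mul_cancel_right]

open Classical in
/-- The restriction of `f ∈ ind_K^G σ` to a set `S` with `K S = S`, extended by zero. -/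
noncomputable def restrictTo (S : Set (unitaryG D))
    (hS : ∀ κ ∈ maxK D i, ∀ g, κ * g ∈ S ↔ g ∈ S) (f : indSpace σ) : indSpace σ :=
  ⟨fun g => if g ∈ S then f.1 g else 0, by
    intro κ g
    simp only [hS κ κ.2]
    split_ifs
    · exact f.2.1 κ g
    · rw [map_zero], by
    have h : IsLocallyConstant fun g => g ∈ S :=
      isLocallyConstant_of_left_invariant (i := i) fun κ hκ g => propext (hS κ hκ g)
    exact (h.prodMk f.2.2.1).comp fun q : Prop × W => if q.1 then q.2 else 0, by
    refine f.2.2.2.mono fun g hg => ?_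
    simp only [Function.mem_support, ne_eq, ite_eq_right_iff, not_forall] at hg
    exact hg.2⟩

open Classical in
theorem restrictTo_apply {S : Set (unitaryG D)} (hS : ∀ κ ∈ maxK D i, ∀ g, κ * g ∈ S ↔ g ∈ S)
    (f : indSpace σ) (g : unitaryG D) :
    (restrictTo S hS f).1 g = if g ∈ S then f.1 g else 0 := rfl

/-- An index `n` with `g ∈ K αⁿ I_K`. -/
noncomputable def index (i : MaxCpt) (g : unitaryG D) : ℤ := (exists_mem_doubleCoset i g).choose

theorem mem_doubleCoset_index (g : unitaryG D) : g ∈ doubleCoset i (alpha D ^ index i g) :=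
  (exists_mem_doubleCoset i g).choose_spec

theorem index_mul_left {κ : unitaryG D} (hκ : κ ∈ maxK D i) (g : unitaryG D) :
    index i (κ * g) = index i g := by
  have h : (fun n : ℤ => κ * g ∈ doubleCoset i (alpha D ^ n)) =
      fun n : ℤ => g ∈ doubleCoset i (alpha D ^ n) := by
    ext n
    have := mul_mem_doubleCoset_iff (g := g) (x := alpha D ^ n) hκ (one_mem (iwahori D i))
    rwa [mul_one] at this
  have key : ∀ (p q : ℤ → Prop) (hp : ∃ n, p n) (hq : ∃ n, q n), p = q → hp.choose = hq.choose := by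
    rintro p q hp hq rfl
    rfl
  exact key _ _ _ _ h

/-- A function in `ind_K^G σ` is a finite sum of functions supported in double cosets `K αⁿ I_K`
that meet its support. -/
theorem mem_of_forall_index {f : indSpace σ} {M : Submodule k (indSpace σ)}
    (h : ∀ n : ℤ, ∀ f' ∈ supportedIn σ (doubleCoset i (alpha D ^ n)),
      (∃ g, f.1 g ≠ 0 ∧ index i g = n) → f' ∈ M) : f ∈ M := by
  have hS : ∀ n : ℤ, ∀ κ ∈ maxK D i, ∀ g, κ * g ∈ index i ⁻¹' {n} ↔ g ∈ index i ⁻¹' {n} := by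
    intro n κ hκ g
    simp only [Set.mem_preimage, index_mul_left hκ]
  have hc : Continuous (index (D := D) i) :=
    (isLocallyConstant_of_left_invariant fun κ hκ g => index_mul_left hκ g).continuous
  have hfin : (index i '' tsupport f.1).Finite := (f.2.2.2.isCompact.image hc).finite_of_discrete
  have hsum : f = ∑ n ∈ hfin.toFinset, restrictTo _ (hS n) f := by
    ext g
    rw [AddSubmonoidClass.coe_finsetSum, Finset.sum_apply]
    simp only [restrictTo_apply, Set.mem_preimage, Set.mem_singleton_iff]
    rw [Finset.sum_ite_eq]
    split_ifs with hg
    · rfl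
    · by_contra hne
      exact hg (hfin.mem_toFinset.2 ⟨g, subset_tsupport _ hne, rfl⟩)
  rw [hsum]
  refine sum_mem fun n _ => ?_
  by_cases h0 : restrictTo _ (hS n) f = 0
  · rw [h0]; exact zero_mem _
  obtain ⟨g, hg⟩ : ∃ g, (restrictTo _ (hS n) f).1 g ≠ 0 := by
    by_contra! hall
    exact h0 (Subtype.ext (funext hall))
  have key : ∀ g, (restrictTo _ (hS n) f).1 g ≠ 0 → index i g = n ∧ f.1 g ≠ 0 := by
    intro g hg
    rw [restrictTo_apply] at hg
    split_ifs at hg with hgn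
    · exact ⟨hgn, hg⟩
    · exact absurd rfl hg
  refine h n _ (fun g hg => ?_) ⟨g, (key g hg).2, (key g hg).1⟩
  rw [← (key g hg).1]
  exact mem_doubleCoset_index g

theorem supportedIn_le_iPlus {n : ℤ} (hn : 0 ≤ n) :
    supportedIn σ (doubleCoset i (alpha D ^ n)) ≤ iPlus σ := by
  obtain ⟨m, rfl⟩ := Int.eq_ofNat_of_zero_le hn
  rw [zpow_natCast]
  exact le_iSup (rPlus σ) m

theorem supportedIn_le_iMinus {n : ℤ} (hn : n < 0) :
    supportedIn σ (doubleCoset i (alpha D ^ n)) ≤ iMinus σ := by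
  obtain ⟨m, hm⟩ := Int.eq_ofNat_of_zero_le (show 0 ≤ -n - 1 by omega)
  obtain rfl : n = -((m : ℤ) + 1) := by omega
  exact le_iSup (rMinus σ) m

/-- `I⁺(σ)` is the space of all functions supported on the plus side. -/
theorem iPlus_eq : iPlus σ = supportedIn σ (plusSide D i) := by
  refine le_antisymm (iSup_le fun n f hf g hg => ?_) fun f hf => ?_
  · have h := hf g hg
    rw [← zpow_natCast] at h
    exact (mem_plusSide_iff h).2 (by omega)
  · refine mem_of_forall_index fun n f' hf' => ?_
    rintro ⟨g, hg, rfl⟩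
    exact supportedIn_le_iPlus ((mem_plusSide_iff (mem_doubleCoset_index g)).1 (hf g hg)) hf'

theorem iMinus_eq : iMinus σ = supportedIn σ (plusSide D i)ᶜ := by
  refine le_antisymm (iSup_le fun n f hf g hg => ?_) fun f hf => ?_
  · exact (mem_plusSide_iff (hf g hg)).not.2 (by omega)
  · refine mem_of_forall_index fun n f' hf' => ?_
    rintro ⟨g, hg, rfl⟩
    refine supportedIn_le_iMinus ?_ hf'
    exact not_le.1 ((mem_plusSide_iff (mem_doubleCoset_index g)).not.1 (hf g hg))

theorem exists_add_eq (f : indSpace σ) : ∃ f₁ ∈ iPlus σ, ∃ f₂ ∈ iMinus σ, f = f₁ + f₂ := by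
  refine (Submodule.mem_sup.1 (mem_of_forall_index (M := iPlus σ ⊔ iMinus σ)
    fun n f' hf' _ => ?_)).imp fun f₁ h => ⟨h.1, h.2.imp fun f₂ h => ⟨h.1, h.2.symm⟩⟩
  rcases le_or_gt 0 n with hn | hn
  · exact Submodule.mem_sup_left (supportedIn_le_iPlus hn hf')
  · exact Submodule.mem_sup_right (supportedIn_le_iMinus hn hf')

theorem mem_invariantsOf_ind {f : indSpace σ} {H : Subgroup (unitaryG D)} :
    f ∈ invariantsOf (ind σ) H ↔ ∀ u ∈ H, ∀ g, f.1 (g * u) = f.1 g := by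
  constructor
  · intro h u hu g
    exact congrFun (congrArg Subtype.val (h ⟨u, hu⟩)) g
  · intro h u
    exact Subtype.ext (funext fun g => h u.1 u.2 g)

/-- If `f` is `I_{1,K}`-invariant off a set `S` that is stable under `K` and `I_K`, then `f` is the
sum of a function supported in `S` and an `I_{1,K}`-invariant one. -/
theorem mem_supportedIn_sup {S : Set (unitaryG D)}
    (hS : ∀ κ ∈ maxK D i, ∀ b ∈ iwahori D i, ∀ g, κ * g * b ∈ S ↔ g ∈ S) {f : indSpace σ}
    (hf : ∀ g ∉ S, ∀ u ∈ proIwahori D i, f.1 (g * u) = f.1 g) :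
    f ∈ supportedIn σ S ⊔ invariantsOf (ind σ) (proIwahori D i) := by
  have hSl : ∀ κ ∈ maxK D i, ∀ g, κ * g ∈ S ↔ g ∈ S := fun κ hκ g => by
    simpa using hS κ hκ 1 (one_mem _) g
  have h2 : f - restrictTo S hSl f ∈ invariantsOf (ind σ) (proIwahori D i) := by
    rw [mem_invariantsOf_ind]
    intro u hu g
    have hgu : g * u ∈ S ↔ g ∈ S := by simpa using hS 1 (one_mem _) u hu.1 g
    change f.1 (g * u) - (restrictTo S hSl f).1 (g * u) = f.1 g - (restrictTo S hSl f).1 g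
    rw [restrictTo_apply, restrictTo_apply]
    by_cases hg : g ∈ S
    · rw [if_pos hg, if_pos (hgu.2 hg), sub_self, sub_self]
    · rw [if_neg hg, if_neg (hgu.not.2 hg), sub_zero, sub_zero, hf g hg u hu]
  refine Submodule.mem_sup.2 ⟨restrictTo S hSl f, fun g hg => ?_, _, h2, add_sub_cancel _ _⟩
  by_contra hgS
  rw [restrictTo_apply, if_neg hgS] at hg
  exact hg rfl

theorem heckeT_mem_invariants {H : Subgroup (unitaryG D)} {f : indSpace σ}
    (hf : f ∈ invariantsOf (ind σ) H) : heckeT σ f ∈ invariantsOf (ind σ) H := by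
  intro u
  have h := Representation.IntertwiningMap.isIntertwining _ _ (heckeT σ) u.1 f
  have h1 : ind σ u.1 f = f := hf u
  rw [h1] at h
  exact h.symm

theorem heckeT_mem_iPlus_sup {f : indSpace σ} (hf : f ∈ iPlus σ) :
    heckeT σ f ∈ iPlus σ ⊔ invariantsOf (ind σ) (proIwahori D i) := by
  induction hf using Submodule.iSup_induction' with
  | mem n f hf =>
    rw [iPlus_eq]
    refine mem_supportedIn_sup (fun κ hκ b hb g => mul_mem_plusSide_iff hκ hb) fun g hg u hu => ?_
    have hg' := mem_doubleCoset_index (i := i) g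
    rw [mem_plusSide_iff hg'] at hg
    exact heckeT_mul_right (n := n) (by rwa [zpow_natCast]) hg' (by omega) hu
  | zero => rw [map_zero]; exact zero_mem _
  | add f₁ f₂ _ _ h₁ h₂ => rw [map_add]; exact add_mem h₁ h₂

theorem heckeT_mem_iMinus_sup {f : indSpace σ} (hf : f ∈ iMinus σ) :
    heckeT σ f ∈ iMinus σ ⊔ invariantsOf (ind σ) (proIwahori D i) := by
  induction hf using Submodule.iSup_induction' with
  | mem n f hf =>
    rw [iMinus_eq]
    refine mem_supportedIn_sup (fun κ hκ b hb g => (mul_mem_plusSide_iff hκ hb).not)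
      fun g hg u hu => ?_
    have hg' := mem_doubleCoset_index (i := i) g
    rw [Set.mem_compl_iff, not_not, mem_plusSide_iff hg'] at hg
    exact heckeT_mul_right hf hg' (by omega) hu
  | zero => rw [map_zero]; exact zero_mem _
  | add f₁ f₂ _ _ h₁ h₂ => rw [map_add]; exact add_mem h₁ h₂

/-- If `T` maps `M` into `M + (ind_K^G σ)^H`, then so does every polynomial in `T`. -/
theorem aeval_heckeT_mem {M : Submodule k (indSpace σ)} {H : Subgroup (unitaryG D)}
    (hM : ∀ f ∈ M, heckeT σ f ∈ M ⊔ invariantsOf (ind σ) H) (P : Polynomial k) {f : indSpace σ}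
    (hf : f ∈ M) : Polynomial.aeval (heckeT σ) P f ∈ M ⊔ invariantsOf (ind σ) H := by
  have hT : ∀ f ∈ M ⊔ invariantsOf (ind σ) H, heckeT σ f ∈ M ⊔ invariantsOf (ind σ) H := by
    intro f hf
    obtain ⟨f₁, h₁, f₂, h₂, rfl⟩ := Submodule.mem_sup.1 hf
    rw [map_add]
    exact add_mem (hM f₁ h₁) (Submodule.mem_sup_right (heckeT_mem_invariants h₂))
  have hpow : ∀ n : ℕ, (heckeT σ ^ n) f ∈ M ⊔ invariantsOf (ind σ) H := by
    intro n
    induction n with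
    | zero => exact Submodule.mem_sup_left hf
    | succ n ih => rw [pow_succ']; exact hT _ ih
  induction P using Polynomial.induction_on' with
  | add p q hp hq => rw [map_add]; exact add_mem hp hq
  | monomial n a =>
    rw [Polynomial.aeval_monomial, ← Algebra.smul_def]
    exact Submodule.smul_mem _ a (hpow n)

theorem ind_mem_iPlus {u : unitaryG D} (hu : u ∈ proIwahori D i) {f : indSpace σ}
    (hf : f ∈ iPlus σ) : ind σ u f ∈ iPlus σ := by
  rw [iPlus_eq] at *
  intro g hg
  simpa using (mul_mem_plusSide_iff (one_mem (maxK D i)) hu.1).1 (by simpa using hf _ hg)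

theorem ind_mem_iMinus {u : unitaryG D} (hu : u ∈ proIwahori D i) {f : indSpace σ}
    (hf : f ∈ iMinus σ) : ind σ u f ∈ iMinus σ := by
  rw [iMinus_eq] at *
  intro g hg hgS
  refine hf _ hg ?_
  simpa using (mul_mem_plusSide_iff (g := g) (one_mem (maxK D i)) hu.1).2 hgS

theorem disjoint_iPlus_iMinus : Disjoint (iPlus σ) (iMinus σ) := by
  rw [iPlus_eq, iMinus_eq, Submodule.disjoint_def]
  intro f h₁ h₂
  refine Subtype.ext (funext fun g => ?_)
  by_contra hg
  exact h₂ g hg (h₁ g hg)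

/-- If the sum of functions on the two sides is `I_{1,K}`-invariant, then so is each of them. -/
theorem mem_invariantsOf_of_add {f₁ f₂ : indSpace σ} (h₁ : f₁ ∈ iPlus σ) (h₂ : f₂ ∈ iMinus σ)
    (h : f₁ + f₂ ∈ invariantsOf (ind σ) (proIwahori D i)) :
    f₁ ∈ invariantsOf (ind σ) (proIwahori D i) := by
  intro u
  have h3 : ind σ u.1 (f₁ + f₂) = f₁ + f₂ := h u
  rw [map_add] at h3
  have h4 : ind σ u.1 f₁ - f₁ = f₂ - ind σ u.1 f₂ := by
    rw [sub_eq_sub_iff_add_eq_add, h3, add_comm]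
  exact sub_eq_zero.1 (Submodule.disjoint_def.1 disjoint_iPlus_iMinus _
    (sub_mem (ind_mem_iPlus u.2 h₁) h₁) (h4 ▸ sub_mem h₂ (ind_mem_iMinus u.2 h₂)))

end Halves

end U21


theorem proposition4p1
    {F E : Type*} [NontriviallyNormedField F] [IsUltrametricDist F] [ProperSpace F]
    [NormedField E] [NormedAlgebra F E] (D : U21.UnramifiedQuadratic F E)
    (p : ℕ) [Fact p.Prime] (hp_odd : p ≠ 2) (hp_res : ‖(p : F)‖ < 1)
    (i : U21.MaxCpt)
    {W : Type*} [AddCommGroup W] [Module (AlgebraicClosure (ZMod p)) W]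
    (σ : Representation (AlgebraicClosure (ZMod p)) (U21.maxK D i) W)
    (hσ_irr : σ.IsIrreducible) (hσ_smooth : U21.IsSmooth σ)
    (P : Polynomial (AlgebraicClosure (ZMod p))) (hP : 1 ≤ P.natDegree) :
    U21.iPlusImage σ P ⊓ U21.iMinusImage σ P ≤
      U21.invariantsOf (U21.heckeModule σ P) (U21.proIwahori D i) := by
  rintro _ ⟨⟨f₁, hf₁, rfl⟩, ⟨f₂, hf₂, h⟩⟩
  obtain ⟨h', hh⟩ : f₁ - f₂ ∈ U21.heckeIdeal σ P := (Submodule.Quotient.eq _).1 h.symm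
  obtain ⟨h₁, hh₁, h₂, hh₂, rfl⟩ := U21.exists_add_eq h'
  obtain ⟨a₁, ha₁, c₁, hc₁, e₁⟩ := Submodule.mem_sup.1
    (U21.aeval_heckeT_mem (fun f hf => U21.heckeT_mem_iPlus_sup hf) P hh₁)
  obtain ⟨a₂, ha₂, c₂, hc₂, e₂⟩ := Submodule.mem_sup.1
    (U21.aeval_heckeT_mem (fun f hf => U21.heckeT_mem_iMinus_sup hf) P hh₂)
  rw [map_add] at hh
  change Polynomial.aeval (U21.heckeT σ) P h₁ + Polynomial.aeval (U21.heckeT σ) P h₂ = _ at hh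
  rw [← e₁, ← e₂] at hh
  have hinv : f₁ - a₁ ∈ U21.invariantsOf (U21.ind σ) (U21.proIwahori D i) := by
    refine U21.mem_invariantsOf_of_add (sub_mem hf₁ ha₁) (neg_mem (add_mem hf₂ ha₂)) ?_
    have : f₁ - a₁ + -(f₂ + a₂) = c₁ + c₂ := by
      rw [← sub_eq_zero, ← sub_eq_zero.2 hh.symm]; abel
    rw [this]
    exact add_mem hc₁ hc₂
  -- Modulo the image of `P(T)`, the function `f₁` agrees with `f₁ - a₁ - c₁`.
  have hinv' := sub_mem hinv hc₁
  have hq : (U21.heckeIdeal σ P).mkQ f₁ = (U21.heckeIdeal σ P).mkQ (f₁ - a₁ - c₁) := by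
    refine (Submodule.Quotient.eq _).2 ⟨h₁, ?_⟩
    change Polynomial.aeval (U21.heckeT σ) P h₁ = _
    rw [← e₁]; abel
  intro u
  rw [hq]
  exact congrArg (U21.heckeIdeal σ P).mkQ (hinv' u)
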